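/- Consider a general multitype branching process on the Ulam--Harris tree $\mathbb T$ of finite sequences of natural numbers: $\mathcal S$ is a measurable type space, $\Omega_\ell$ a measurable space of life careers carrying measurable functions $0\le\tau(1)\le\tau(2)\le\dots\le\infty$ (the mother's age at the birth of the $k$-th child, $\infty$ meaning never born) and $\sigma(k)\in\mathcal S$ (the type of the $k$-th child), and $P(s,\cdot)$ is a probability kernel from $\mathcal S$ to $\Omega_\ell$. Let $\mathbb P_s$ be the law on $\mathcal S\times\Omega_\ell^{\mathbb T}$ under which the ancestor has type $s$ and every individual $x$, given its type $\sigma_x$, has a life with law $P(\sigma_x,\cdot)$, independently of all individuals not stemming from $x$. Birth times are $0$ for the ancestor and (mother's birth time) $+$ (mother's age at the birth) for other individuals; an individual is realised if its birth time is finite. Let $E$ be the event that only finitely many individuals are realised, $q_s=\mathbb P_s(E)$, and, when $q_s>0$, $\tilde{\mathbb P}_s=\mathbb P_s(\cdot\mid E)$. Let $X_n(A)\in\{0,1,\dots,\infty\}$ be the number of realised individuals of generation $n$ with type in $A\subseteq\mathcal S$. Expectations of non-negative variables take values in $[0,\infty]$, with $\log 0=-\infty$, $e^{-\infty}=0$,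 $\infty\cdot 0=0$, and $q^\infty=0$ for $0\le q<1$, $1^\infty=1$. A law of the process is called subcritical if the expected size of the $n$-th generation tends to $0$ as $n\to\infty$. (1) Suppose $q:=\sup_{r\in\mathcal S}q_r<1$. Then for every $s$ with $q_s>0$: (a) for every $n\ge 0$, $$\tilde{\mathbb E}_s[X_n(\mathcal S)]=\frac1{q_s}\,\mathbb E_s\Big[X_n(\mathcal S)\,e^{\int_{\mathcal S}\log q_r\,X_n(dr)}\Big]\le\frac1{q_s}\,\mathbb E_s\big[X_n(\mathcal S)\,q^{X_n(\mathcal S)}\big];$$ (b) $\tilde{\mathbb E}_s[X_n(\mathcal S)]\to0$ as $n\to\infty$, that is, the conditioned process is subcritical; (c) if $\mathbb P_s$-almost surely $X_n(\mathcal S)$ tends either to $0$ or to $\infty$, then also the bound $\mathbb E_s[X_n(\mathcal S)q^{X_n(\mathcal S)}]/q_s$ tends to $0$; this dichotomy holds whenever $\inf_{r\in\mathcal S}q_r>0$. (2) Suppose there is a single type, and write $q>0$ for the extinction probability and $X$ for the ancestor's total number of children. Then $\tilde{\mathbb E}[X]=\mathbb E[Xq^{X-1}]$. If the process is supercritical,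 $\mathbb E[X]>1$, then $q<1$. If $q<1$, then the generating function $f(t)=\sum_{k\ge0}\mathbb P(X=k)t^k$ is differentiable at $q$, $\tilde{\mathbb E}[X]=f'(q)<1$, and the conditioned process is subcritical. -/

import Mathlib

open MeasureTheory ProbabilityTheory Filter Topology
open scoped ENNReal

noncomputable section

namespace Branching

/-- The Ulam--Harris set of possible individuals. The list `k :: m` stands for the child of rank `k`
of the individual `m`; the ancestor (Eve) is `[]`. Hence the mother is the tail of the list and the
generation is its length. Ranks start at `0`. -/
abbrev Individual : Type := List ℕ

/-- A life space `L` over the type space `S`: the mother's age `τ k ∈ [0, ∞]` at the birth of the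
child of rank `k` (`∞` if that child is never born), and the type `σ k` of that child. -/
structure LifeSpace (S L : Type*) [MeasurableSpace S] [MeasurableSpace L] where
  τ : ℕ → L → ℝ≥0∞
  σ : ℕ → L → S
  measurable_τ : ∀ k, Measurable (τ k)
  measurable_σ : ∀ k, Measurable (σ k)
  monotone_τ : ∀ l, Monotone fun k => τ k l

/-- The population space: the type of the ancestor and a life career for each individual. -/
abbrev Population (S L : Type*) : Type _ := S × (Individual → L)

variable {S L : Type*} [MeasurableSpace S] [MeasurableSpace L]

namespace LifeSpace

variable (D : LifeSpace S L)

/-- The type `σ_x` of the individual `x`. -/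
def type (ω : Population S L) : Individual → S
  | [] => ω.1
  | k :: m => D.σ k (ω.2 m)

/-- The birth time `t_x` of the individual `x`. -/
def birthTime (ω : Population S L) : Individual → ℝ≥0∞
  | [] => 0
  | k :: m => birthTime ω m + D.τ k (ω.2 m)

/-- The set of realised individuals. -/
def realised (ω : Population S L) : Set Individual := {x | D.birthTime ω x < ∞}

/-- The realised individuals of generation `n`. -/
def generation (n : ℕ) (ω : Population S L) : Set Individual :=
  {x | x.length = n} ∩ D.realised ω

/-- `X_n(A)`: the number of realised individuals of generation `n` with type in `A`. -/
def genCount (n : ℕ) (A : Set S) (ω : Population S L) : ℕ∞ :=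
  {x ∈ D.generation n ω | D.type ω x ∈ A}.encard

/-- The size `X_n(S)` of generation `n`. -/
def genSize (n : ℕ) (ω : Population S L) : ℕ∞ := D.genCount n Set.univ ω

/-- `X_n(dr)` as a (random) measure on the type space. -/
def genMeasure (n : ℕ) (ω : Population S L) : Measure S :=
  Measure.sum fun x : D.generation n ω => Measure.dirac (D.type ω x)

theorem genMeasure_apply (n : ℕ) (ω : Population S L) {A : Set S} (hA : MeasurableSet A) :
    D.genMeasure n ω A = (D.genCount n A ω : ℝ≥0∞) := by
  rw [genMeasure, Measure.sum_apply _ hA, genCount]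
  simp_rw [Measure.dirac_apply' _ hA]
  have h : {x ∈ D.generation n ω | D.type ω x ∈ A}
      = Subtype.val '' {x : D.generation n ω | D.type ω x ∈ A} := by
    ext x; simp [and_comm]
  rw [h, Subtype.val_injective.encard_image, ← ENNReal.tsum_set_one,
    tsum_subtype {x : D.generation n ω | D.type ω x ∈ A} fun _ => (1 : ℝ≥0∞)]
  rfl

/-- The event that the process started from Eve dies out. -/
def extinction : Set (Population S L) := {ω | (D.realised ω).Finite}

/-- The total number of children in a life career. -/
def offspring (l : L) : ℕ∞ := {k | D.τ k l < ∞}.encard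

end LifeSpace

/-! ### The population law

Individuals are enumerated by `Denumerable (List ℕ)`. Eve has number `0` and each mother precedes
her children, so the lives can be drawn one after the other: given all earlier lives, the life of
`x` is drawn from `P (σ_x)`. -/

theorem encode_tail_le (n : ℕ) :
    Encodable.encode (Denumerable.ofNat (List ℕ) (n + 1)).tail ≤ n := by
  have h := Denumerable.encode_ofNat (α := List ℕ) (n + 1)
  generalize Denumerable.ofNat (List ℕ) (n + 1) = x at h ⊢
  cases x with
  | nil => simp
  | cons k m =>
    rw [Encodable.encode_list_cons] at h
    have h2 := Nat.right_le_pair (Encodable.encode k) (Encodable.encode m)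
    simp only [List.tail_cons]
    omega

/-- The type of the individual with number `n + 1`, read off from the lives of the individuals with
numbers at most `n`, one of whom is her mother. -/
def nextType (D : LifeSpace S L) (n : ℕ) (h : (i : Finset.Iic n) → L) : S :=
  D.σ (Denumerable.ofNat (List ℕ) (n + 1)).headI
    (h ⟨Encodable.encode (Denumerable.ofNat (List ℕ) (n + 1)).tail,
      Finset.mem_Iic.2 (encode_tail_le n)⟩)

theorem measurable_nextType (D : LifeSpace S L) (n : ℕ) : Measurable (nextType D n) :=
  (D.measurable_σ _).comp (measurable_pi_apply _)

/-- The conditional law of the life with number `n + 1` given the lives with numbers at most `n`. -/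
def stepKernel (D : LifeSpace S L) (P : Kernel S L) (n : ℕ) :
    Kernel ((i : Finset.Iic n) → L) L :=
  P.comap (nextType D n) (measurable_nextType D n)

instance (D : LifeSpace S L) (P : Kernel S L) [IsMarkovKernel P] (n : ℕ) :
    IsMarkovKernel (stepKernel D P n) := by
  unfold stepKernel; infer_instance

/-- The joint law of all lives, in the order of the enumeration, as a function of Eve's type. -/
def livesKernel (D : LifeSpace S L) (P : Kernel S L) [IsMarkovKernel P] :
    Kernel S (ℕ → L) :=
  Kernel.traj (X := fun _ => L) (stepKernel D P) 0 ∘ₖ P.map fun l _ => l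

/-- The population law `ℙ_s`, as a kernel in the type `s` of Eve. -/
def popLaw (D : LifeSpace S L) (P : Kernel S L) [IsMarkovKernel P] :
    Kernel S (Population S L) :=
  (Kernel.id ×ₖ livesKernel D P).map
    fun p => (p.1, fun x : Individual => p.2 (Encodable.encode x))

/-- The extinction probability `q_s`. -/
def extProb (D : LifeSpace S L) (P : Kernel S L) [IsMarkovKernel P] (s : S) : ℝ≥0∞ :=
  popLaw D P s D.extinction

/-- The population law conditioned on extinction; meaningful when `q_s > 0`. -/
def condLaw (D : LifeSpace S L) (P : Kernel S L) [IsMarkovKernel P] (s : S) :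
    Measure (Population S L) :=
  (popLaw D P s)[|D.extinction]

/-- A law on the population space is subcritical if the expected generation sizes tend to `0`. -/
def IsSubcritical (D : LifeSpace S L) (μ : Measure (Population S L)) : Prop :=
  Tendsto (fun n => ∫⁻ ω, (D.genSize n ω : ℝ≥0∞) ∂μ) atTop (𝓝 0)

/-- `a ^ m` for `a ∈ [0, 1]` and `m ∈ ℕ ∪ {∞}`, where `a ^ ∞` is the limit of `a ^ k`. -/
def powENat (a : ℝ≥0∞) : ℕ∞ → ℝ≥0∞
  | (k : ℕ) => a ^ k
  | ⊤ => ⨅ k : ℕ, a ^ k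

/-- `exp (∫ log q_r X_n(dr)) ∈ [0, 1]`, with `log 0 = -∞` and `exp (-∞) = 0`. The integrand is
non-positive, so the integral is minus the Lebesgue integral of `- log q_r ∈ [0, ∞]`. -/
def extWeight (D : LifeSpace S L) (P : Kernel S L) [IsMarkovKernel P] (n : ℕ)
    (ω : Population S L) : ℝ≥0∞ :=
  EReal.exp (-((∫⁻ r, (-ENNReal.log (extProb D P r)).toENNReal ∂(D.genMeasure n ω) : ℝ≥0∞) : EReal))

/-- The offspring generating function `f(t) = ∑ₖ P(X = k) tᵏ` of individuals of type `s`. -/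
def offspringGF (D : LifeSpace S L) (P : Kernel S L) (s : S) (t : ℝ) : ℝ :=
  ∑' k : ℕ, (P s).real {l | D.offspring l = k} * t ^ k

end Branching

end

/-! ### Drawing a single life afresh. -/

noncomputable section

namespace Branching

/-! Given the lives before generation `n`, the populations stemming from its realised members are
independent with laws `ℙ_{σ_x}`. Hence they all die out with conditional probability `∏ q_{σ_x} =
exp ∫ log q_r X_n(dr)` (`lintegral_mul_indicator_subPopsIn`). When `q = sup q_r < 1`, this vanishes
on an infinite generation, so almost surely the event is extinction itself
(`ae_mem_extinction_of_mem_subPopsIn`). This gives (a), with `X_n` replaced by any functional of the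
lives before generation `n`.

For (b), cut at a level `K`. The part `X_n < K` is bounded and vanishes eventually on extinction;
the part `X_n ≥ K` is controlled uniformly in `n` by `m q ^ m`, which is small for large `m`. For
(c), `m q ^ m` is bounded and tends to `0` at `0` and at `∞`. The dichotomy holds because each visit
of `X_n` to `{1, ..., K}` leaves a chance of at least `(inf q_r) ^ K` of extinction, so infinitely
many visits have probability `0`.

With one type, the iterates of `f` from `0` show that `q ≤ t` whenever `f(t) ≤ t`. The tangent
inequality `t ^ k + (1 - t) k t ^ (k - 1) ≤ 1` yields such a `t < 1` in the supercritical case. At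
`t = q`, where `f(q) = q`, it gives `f'(q) ≤ 1`; equality would force `f(0) = 0`, hence `q = 0`.

The branching property is derived from the sequential construction of the law one life at a time,
first for functionals of finitely many lives. -/

theorem lintegral_traj_succ {L : Type*} [MeasurableSpace L]
    {κ : (n : ℕ) → Kernel ((i : Finset.Iic n) → L) L} [∀ n, IsMarkovKernel (κ n)]
    (x₀ : (i : Finset.Iic 0) → L) (n : ℕ) {F : (ℕ → L) → ℝ≥0∞}
    (hF : Measurable F) (hdep : DependsOn F (Set.Iic (n + 1))) :
    ∫⁻ w, F w ∂Kernel.traj (X := fun _ => L) κ 0 x₀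
      = ∫⁻ w, ∫⁻ l, F (Function.update w (n + 1) l) ∂κ n (Preorder.frestrictLe n w)
          ∂Kernel.traj (X := fun _ => L) κ 0 x₀ := by
  -- The inner integral must be a function of the first coordinates alone; `e` fills the others with
  -- a dummy value that `hdep` makes irrelevant.
  let e : ((i : Finset.Iic n) → L) → ℕ → L :=
    fun u => Function.updateFinset (fun _ => x₀ ⟨0, by simp⟩) (Finset.Iic n) u
  have he : Measurable e := measurable_updateFinset
  let H : ((i : Finset.Iic n) → L) → ℝ≥0∞ :=
    fun u => ∫⁻ l, F (Function.update (e u) (n + 1) l) ∂κ n u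
  have hFu : Measurable fun p : ((i : Finset.Iic n) → L) × L =>
      F (Function.update (e p.1) (n + 1) p.2) := by
    refine hF.comp (measurable_pi_iff.2 fun y => ?_)
    by_cases h : y = n + 1
    · subst h; simpa using measurable_snd
    · simp only [Function.update_of_ne h]
      exact (measurable_pi_apply y).comp (he.comp measurable_fst)
  have hH : Measurable H := hFu.lintegral_kernel_prod_right'
  have h1 : ∀ u, ∫⁻ w, F w ∂Kernel.traj (X := fun _ => L) κ n u = H u := by
    intro u
    rw [Kernel.lintegral_traj u hF]
    have h2 : κ n u = (Kernel.traj (X := fun _ => L) κ n u).map (fun x => x (n + 1)) := by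
      rw [← Kernel.map_apply _ (by fun_prop), Kernel.map_traj_succ_self]
    simp only [H]
    conv_rhs => rw [h2]
    rw [lintegral_map (f := fun l => F (Function.update (e u) (n + 1) l))
      (hFu.comp measurable_prodMk_left) (by fun_prop)]
    congr with w
    refine hdep fun i hi => ?_
    by_cases h : i = n + 1
    · subst h; simp [Function.updateFinset]
    · have : i ≤ n := by simp at hi; omega
      simp [Function.update_of_ne h, e, Function.updateFinset, this]
  rw [← Kernel.traj_comp_partialTraj (Nat.zero_le n), Kernel.lintegral_comp _ _ _ hF,
    Kernel.traj_comp_partialTraj (Nat.zero_le n)]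
  simp_rw [h1]
  rw [← Kernel.traj_map_frestrictLe_apply, lintegral_map hH (by fun_prop)]
  congr with w
  simp only [H]
  congr with l
  refine hdep fun i hi => ?_
  by_cases h : i = n + 1
  · subst h; simp
  · have : i ≤ n := by simp at hi; omega
    simp [Function.update_of_ne h, e, Function.updateFinset, this]


section

variable {S L : Type*}

/-- `G` depends on the ancestor's type and the lives of the individuals in `A` only. -/
def DependsOnLives {β : Type*} (G : Population S L → β) (A : Set Individual) : Prop :=
  ∀ ⦃s : S⦄ ⦃w w' : Individual → L⦄, (∀ y ∈ A, w y = w' y) → G (s, w) = G (s, w')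

theorem DependsOnLives.mono {β : Type*} {G : Population S L → β} {A B : Set Individual}
    (hG : DependsOnLives G A) (hAB : A ⊆ B) : DependsOnLives G B :=
  fun _ _ _ h => hG fun y hy => h y (hAB hy)

end

variable {S L : Type*} [MeasurableSpace S] [MeasurableSpace L]

theorem encode_lt_encode_cons (k : ℕ) (m : Individual) :
    Encodable.encode m < Encodable.encode (k :: m) := by
  rw [Encodable.encode_list_cons]
  exact Nat.lt_succ_of_le (Nat.right_le_pair _ _)

theorem encode_le_encode_append (u m : Individual) :
    Encodable.encode m ≤ Encodable.encode (u ++ m) := by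
  induction u with
  | nil => simp
  | cons k u ih => exact ih.trans (encode_lt_encode_cons k (u ++ m)).le

namespace LifeSpace

variable (D : LifeSpace S L)

theorem type_congr {s : S} {w w' : Individual → L} {x : Individual}
    (h : ∀ k m, x = k :: m → w m = w' m) : D.type (s, w) x = D.type (s, w') x := by
  cases x with
  | nil => rfl
  | cons k m => simp only [type, h k m rfl]

@[fun_prop]
theorem measurable_type (x : Individual) : Measurable fun ω : Population S L => D.type ω x := by
  cases x with
  | nil => exact measurable_fst
  | cons k m => exact (D.measurable_σ k).comp (by fun_prop)

@[fun_prop]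
theorem measurable_birthTime (x : Individual) :
    Measurable fun ω : Population S L => D.birthTime ω x := by
  induction x with
  | nil => exact measurable_const
  | cons k m ih => exact ih.add ((D.measurable_τ k).comp (by fun_prop))

end LifeSpace

variable (D : LifeSpace S L) (P : Kernel S L)

/-- The effect on `G` of drawing the life of `x` afresh. -/
def resample (x : Individual) (G : Population S L → ℝ≥0∞) (ω : Population S L) : ℝ≥0∞ :=
  ∫⁻ l, G (ω.1, Function.update ω.2 x l) ∂P (D.type ω x)

theorem measurable_update_life (x : Individual) :
    Measurable fun p : Population S L × L => (p.1.1, Function.update p.1.2 x p.2) := by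
  refine measurable_fst.fst.prodMk (measurable_pi_iff.2 fun y => ?_)
  by_cases h : y = x
  · subst h; simpa using measurable_snd
  · simp only [Function.update_of_ne h]; fun_prop

variable {D P}

theorem measurable_resample [IsSFiniteKernel P] (x : Individual) {G : Population S L → ℝ≥0∞}
    (hG : Measurable G) : Measurable (resample D P x G) := by
  have h : Measurable fun ω : Population S L => D.type ω x := D.measurable_type x
  have := Measurable.lintegral_kernel_prod_right' (κ := P.comap _ h)
    (hG.comp (measurable_update_life (S := S) (L := L) x))
  exact this

/-- Resampling forgets the life of `x` but reads the type of `x`, which is stored in the life of the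
mother. -/
theorem DependsOnLives.resample {x : Individual} {G : Population S L → ℝ≥0∞} {A : Set Individual}
    (hG : DependsOnLives G A) (hx : ∀ k m, x = k :: m → m ∈ A) :
    DependsOnLives (resample D P x G) (A \ {x} ∪ {m | ∃ k, x = k :: m}) := by
  intro s w w' h
  have ht : D.type (s, w) x = D.type (s, w') x :=
    D.type_congr fun k m e => h m (Or.inr ⟨k, e⟩)
  simp only [Branching.resample, ht]
  congr with l
  refine hG fun y hy => ?_
  by_cases hyx : y = x
  · subst hyx; simp
  · simp [Function.update_of_ne hyx, h y (Or.inl ⟨hy, hyx⟩)]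

variable [IsMarkovKernel P]

instance : IsMarkovKernel (livesKernel D P) := by
  have := Kernel.IsMarkovKernel.map P (f := fun (l : L) (_ : Finset.Iic 0) => l) (by fun_prop)
  unfold livesKernel; infer_instance

theorem measurable_popLaw_map : Measurable fun p : S × (ℕ → L) =>
    ((p.1, fun x : Individual => p.2 (Encodable.encode x)) : Population S L) := by
  fun_prop

instance : IsMarkovKernel (popLaw D P) :=
  Kernel.IsMarkovKernel.map _ measurable_popLaw_map

theorem lintegral_popLaw (s : S) {G : Population S L → ℝ≥0∞} (hG : Measurable G) :
    ∫⁻ ω, G ω ∂popLaw D P s = ∫⁻ l, ∫⁻ w, G (s, fun x => w (Encodable.encode x))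
      ∂Kernel.traj (X := fun _ => L) (stepKernel D P) 0 (fun _ => l) ∂P s := by
  have h2 : Measurable fun w : ℕ → L =>
      G (s, fun x : Individual => w (Encodable.encode x)) := by fun_prop
  rw [popLaw, Kernel.lintegral_map _ measurable_popLaw_map _ hG, Kernel.lintegral_id_prod
    (by fun_prop), livesKernel, Kernel.lintegral_comp _ _ _ h2, Kernel.lintegral_map]
  · fun_prop
  · exact h2.lintegral_kernel


-- No life drawn after that of `x` matters to `G`, so drawing `x` is the last relevant step of the
-- trajectory, and `nextType` reads the type of `x` off the mother's life.
open Encodable in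
theorem lintegral_popLaw_eq_resample_of_encode_le (s : S) (x : Individual)
    {G : Population S L → ℝ≥0∞} (hG : Measurable G)
    (hdep : DependsOnLives G {y | encode y ≤ encode x}) :
    ∫⁻ ω, G ω ∂popLaw D P s = ∫⁻ ω, resample D P x G ω ∂popLaw D P s := by
  rw [lintegral_popLaw s hG, lintegral_popLaw s (measurable_resample x hG)]
  have hm : Measurable fun w : ℕ → L => G (s, fun y : Individual => w (encode y)) := by fun_prop
  cases x with
  | nil =>
    have h0 : ∀ l, ∫⁻ w, G (s, fun y => w (encode y))
        ∂Kernel.traj (X := fun _ => L) (stepKernel D P) 0 (fun _ => l) = G (s, fun _ => l) := by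
      intro l
      rw [Kernel.lintegral_traj _ hm]
      refine (lintegral_congr (g := fun _ => G (s, fun _ => l)) fun w =>
        hdep fun y hy => ?_).trans ?_
      · have : encode y = 0 := by simpa using hy
        simp [Function.updateFinset, this]
      · simp
    simp_rw [h0]
    have h1 : ∀ w : Individual → L, resample D P [] G (s, w) = ∫⁻ l, G (s, fun _ => l) ∂P s := by
      intro w
      refine lintegral_congr fun l => hdep fun y hy => ?_
      have : y = [] := encode_injective (by simpa using hy)
      subst this; simp
    simp_rw [h1]
    simp
  | cons k m =>
    obtain ⟨n, hn⟩ : ∃ n, encode (k :: m) = n + 1 := ⟨_, encode_list_cons k m⟩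
    have hx : Denumerable.ofNat (List ℕ) (n + 1) = k :: m := by
      rw [← hn, Denumerable.ofNat_encode]
    refine lintegral_congr fun l => ?_
    rw [lintegral_traj_succ _ n hm]
    · refine lintegral_congr fun w => ?_
      simp only [stepKernel, Kernel.comap_apply, resample, LifeSpace.type]
      have : nextType D n (Preorder.frestrictLe n w) = D.σ k (w (encode m)) := by
        simp only [nextType, Preorder.frestrictLe_apply]
        have := congrArg List.tail hx
        have h2 := congrArg List.headI hx
        simp only [List.tail_cons, List.headI_cons] at this h2
        rw [this, h2]
      rw [this]
      refine lintegral_congr fun l' => ?_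
      congr 2
      ext y
      by_cases h : y = k :: m
      · subst h; simp [hn]
      · have : encode y ≠ n + 1 := fun e => h (encode_injective (e.trans hn.symm))
        simp [Function.update_of_ne h, Function.update_of_ne this]
    · intro w w' h
      exact hdep fun y hy => h _ (by simpa [hn] using hy)

end Branching
end

/-! ### The branching property for one individual. -/

noncomputable section

namespace Branching

open Encodable

/-- Cylinders form a generating π-system and see finitely many lives only. This extends identities
obtained by induction over the enumeration to all measurable functionals. -/
theorem measure_ext_of_dependsOn {X L : Type*} [MeasurableSpace X] [MeasurableSpace L]
    {μ ν : Measure (X × (Individual → L))} [IsFiniteMeasure μ]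
    (h : ∀ (n : ℕ) (F : X × (Individual → L) → ℝ≥0∞), Measurable F →
      (∀ a, DependsOn (fun w => F (a, w)) {y | encode y < n}) → ∫⁻ p, F p ∂μ = ∫⁻ p, F p ∂ν) :
    μ = ν := by
  have hgen : (inferInstance : MeasurableSpace (X × (Individual → L))) =
      MeasurableSpace.generateFrom (Set.image2 (· ×ˢ ·) {A : Set X | MeasurableSet A}
        (measurableCylinders fun _ : Individual => L)) := by
    refine (generateFrom_eq_prod MeasurableSpace.generateFrom_measurableSet
      generateFrom_measurableCylinders isCountablySpanning_measurableSet
      ⟨fun _ => Set.univ, fun _ => univ_mem_measurableCylinders _, Set.iUnion_const _⟩).symm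
  refine ext_of_generate_finite _ hgen
    (MeasurableSpace.isPiSystem_measurableSet.prod isPiSystem_measurableCylinders) ?_ ?_
  · rintro _ ⟨A, hA, B, hB, rfl⟩
    have hAB : MeasurableSet (A ×ˢ B) := hA.prod (MeasurableSet.of_mem_measurableCylinders hB)
    rw [← lintegral_indicator_one hAB, ← lintegral_indicator_one hAB]
    obtain ⟨I, T, -, rfl⟩ := (mem_measurableCylinders _).1 hB
    refine h (I.sup encode + 1) _ (measurable_one.indicator hAB) fun a w w' hw => ?_
    have : I.restrict w = I.restrict w' := by
      ext i
      exact hw _ (Nat.lt_succ_of_le (Finset.le_sup (f := encode) i.2))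
    have e : ((a, w) ∈ A ×ˢ cylinder I T) ↔ ((a, w') ∈ A ×ˢ cylinder I T) :=
      and_congr Iff.rfl (by rw [mem_cylinder, mem_cylinder, this])
    by_cases h1 : (a, w) ∈ A ×ˢ cylinder I T
    · simp only [Set.indicator_of_mem h1, Set.indicator_of_mem (e.1 h1), Pi.one_apply]
    · simp only [Set.indicator_of_notMem h1, Set.indicator_of_notMem (mt e.2 h1)]
  · simpa using h 0 (fun _ => 1) measurable_one fun a w w' _ => rfl

variable {S L : Type*}

open Classical in
/-- Replace the lives of the individuals outside `A` by those of `w₀`. -/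
def cutLives (A : Set Individual) (w₀ : Individual → L) (ω : Population S L) : Population S L :=
  (ω.1, fun y => if y ∈ A then ω.2 y else w₀ y)

theorem dependsOnLives_cutLives (A : Set Individual) (w₀ : Individual → L) :
    DependsOnLives (cutLives (S := S) A w₀) A := by
  intro s w w' h
  simp only [cutLives, Prod.mk.injEq, true_and]
  ext y
  split_ifs with hy
  exacts [h y hy, rfl]

theorem DependsOnLives.apply_cutLives {β : Type*} {G : Population S L → β} {A : Set Individual}
    (hG : DependsOnLives G A) (w₀ : Individual → L) (ω : Population S L) :
    G (cutLives A w₀ ω) = G ω :=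
  hG fun y hy => by simp [hy]

theorem DependsOnLives.comp {β γ : Type*} {G : Population S L → β} {A : Set Individual}
    (hG : DependsOnLives G A) (f : β → γ) : DependsOnLives (fun ω => f (G ω)) A :=
  fun _ _ _ h => congrArg f (hG h)

variable [MeasurableSpace S] [MeasurableSpace L]

@[fun_prop]
theorem measurable_cutLives (A : Set Individual) (w₀ : Individual → L) :
    Measurable (cutLives (S := S) A w₀) := by
  classical
  refine measurable_fst.prodMk (measurable_pi_iff.2 fun y => ?_)
  by_cases hy : y ∈ A
  · simp only [hy, if_true]; fun_prop
  · simp only [hy, if_false]; fun_prop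

variable {D : LifeSpace S L} {P : Kernel S L} [IsMarkovKernel P]

/-- If neither individual is the other's mother, neither type reads the other's life, and Tonelli's
theorem applies. -/
theorem resample_comm {x z : Individual} (hzx : z ≠ x) (hx : ∀ k, x ≠ k :: z) (hz : ∀ k, z ≠ k :: x)
    {G : Population S L → ℝ≥0∞} (hG : Measurable G) (ω : Population S L) :
    resample D P x (resample D P z G) ω = resample D P z (resample D P x G) ω := by
  obtain ⟨s, w⟩ := ω
  have h1 : ∀ l, D.type (s, Function.update w x l) z = D.type (s, w) z := fun l =>
    D.type_congr fun k m e => Function.update_of_ne (by rintro rfl; exact hz k e) _ _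
  have h2 : ∀ l, D.type (s, Function.update w z l) x = D.type (s, w) x := fun l =>
    D.type_congr fun k m e => Function.update_of_ne (by rintro rfl; exact hx k e) _ _
  simp only [resample, h1, h2]
  rw [lintegral_lintegral_swap]
  · simp_rw [Function.update_comm hzx]
  · have h3 : Measurable fun p : L × L =>
        ((s, Function.update (Function.update w x p.1) z p.2) : Population S L) := by
      have := (measurable_update_life (S := S) (L := L) z).comp
        (((measurable_update_life (S := S) (L := L) x).comp
          (measurable_prodMk_left (x := (s, w)))).prodMap measurable_id)
      exact this
    exact (hG.comp h3).aemeasurable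

/-- Induction on the largest number `N` that `G` sees. Let `z` be the individual with number `N +
1`, drawn after `x`. If `z` stems from `x`, then `G` ignores it. Otherwise resample `z`, which
leaves a functional of numbers up to `N`; resample `x` by induction; commute the two operations and
undo the resampling of `z`. -/
theorem lintegral_eq_resample_of_finite (s : S) (x : Individual) (N : ℕ)
    {G : Population S L → ℝ≥0∞} (hG : Measurable G)
    (hdep : DependsOnLives G {y | encode y ≤ N ∧ (x <:+ y → y = x)}) :
    ∫⁻ ω, G ω ∂popLaw D P s = ∫⁻ ω, resample D P x G ω ∂popLaw D P s := by
  induction N generalizing G with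
  | zero =>
    refine lintegral_popLaw_eq_resample_of_encode_le s x hG (hdep.mono fun y hy => ?_)
    exact hy.1.trans (Nat.zero_le _)
  | succ N ih =>
    rcases le_or_gt (N + 1) (encode x) with hN | hN
    · exact lintegral_popLaw_eq_resample_of_encode_le s x hG
        (hdep.mono fun y hy => hy.1.trans hN)
    let z : Individual := Denumerable.ofNat _ (N + 1)
    have hz : encode z = N + 1 := Denumerable.encode_ofNat _
    have hzx : z ≠ x := by rintro h; rw [← h] at hN; omega
    by_cases hxz : x <:+ z
    · refine ih hG (hdep.mono fun y hy => ⟨?_, hy.2⟩)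
      have h1 := hy.1
      have : encode y ≠ N + 1 := fun e => by
        have : y = z := encode_injective (e.trans hz.symm)
        subst this
        exact hzx (hy.2 hxz)
      omega
    have htail : ∀ k m, z = k :: m → encode m ≤ N := fun k m e => by
      have := encode_lt_encode_cons k m
      rw [← e] at this; omega
    have hxtail : ∀ k m, z = k :: m → ¬ x <:+ m := fun k m e h =>
      hxz (e ▸ h.trans (List.suffix_cons k m))
    rw [lintegral_popLaw_eq_resample_of_encode_le s z hG (hdep.mono fun y hy => hy.1.trans hz.ge),
      ih (measurable_resample z hG)]
    · simp_rw [resample_comm (D := D) (P := P) hzx (fun k e => by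
        have := encode_lt_encode_cons k z
        rw [← e] at this; omega) (fun k e => hxtail k x e List.suffix_rfl) hG]
      refine (lintegral_popLaw_eq_resample_of_encode_le s z (measurable_resample x hG) ?_).symm
      refine (hdep.mono (B := {y | encode y ≤ N + 1}) fun y hy => hy.1).resample (fun k m e => ?_)
        |>.mono ?_
      · have := encode_lt_encode_cons k m
        simp only [Set.mem_ofPred_eq]
        rw [← e] at this; omega
      · rintro y (hy | ⟨k, e⟩)
        · exact hy.1.trans hz.ge
        · have := encode_lt_encode_cons k y
          simp only [Set.mem_ofPred_eq]
          rw [← e] at this; omega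
    · refine (hdep.resample (fun k m e => ⟨(htail k m e).trans (Nat.le_succ _),
        fun h => absurd h (hxtail k m e)⟩)).mono ?_
      rintro y (⟨hy, hyz⟩ | ⟨k, e⟩)
      · refine ⟨?_, hy.2⟩
        have h1 := hy.1
        have : encode y ≠ N + 1 := fun e => hyz (encode_injective (e.trans hz.symm))
        omega
      · exact ⟨htail k y e, fun h => absurd h (hxtail k y e)⟩

/-- Makes the resampled population law a genuine measure, to which `measure_ext_of_dependsOn`
applies. -/
theorem exists_kernel_resample (x : Individual) :
    ∃ κ : Kernel (Population S L) (Population S L), IsMarkovKernel κ ∧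
      ∀ G : Population S L → ℝ≥0∞, Measurable G → ∀ ω,
        ∫⁻ ω', G ω' ∂κ ω = resample D P x G ω := by
  let κ := P.comap (fun ω : Population S L => D.type ω x) (D.measurable_type x)
  refine ⟨(Kernel.id ×ₖ κ).map fun p => (p.1.1, Function.update p.1.2 x p.2),
    Kernel.IsMarkovKernel.map _ (measurable_update_life x), fun G hG ω => ?_⟩
  rw [Kernel.lintegral_map _ (measurable_update_life x) _ hG,
    Kernel.lintegral_id_prod
      (f := fun p : Population S L × L => G (p.1.1, Function.update p.1.2 x p.2))
      (hG.comp (measurable_update_life x))]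
  rfl

theorem nonempty_lives (P : Kernel S L) [IsMarkovKernel P] (s : S) : Nonempty (Individual → L) :=
  have : Nonempty L := nonempty_of_isProbabilityMeasure (P s)
  inferInstance

/-- The life of `x`, given the lives of all individuals not stemming from `x`, has law
`P (σ_x)`. -/
theorem lintegral_eq_resample (s : S) (x : Individual)
    {G : Population S L → ℝ≥0∞} (hG : Measurable G)
    (hdep : DependsOnLives G {y | x <:+ y → y = x}) :
    ∫⁻ ω, G ω ∂popLaw D P s = ∫⁻ ω, resample D P x G ω ∂popLaw D P s := by
  obtain ⟨w₀⟩ := nonempty_lives P s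
  obtain ⟨κ, hκ, hκG⟩ := exists_kernel_resample (D := D) (P := P) x
  let c := cutLives (S := S) {y | x <:+ y → y = x} w₀
  have hc : Measurable c := measurable_cutLives _ _
  -- Cutting off the strict descendants of `x` does not change `G`, and it makes every functional of
  -- finitely many lives admissible in the finite case.
  have key : (popLaw D P s).map c = ((popLaw D P s).bind κ).map c := by
    refine measure_ext_of_dependsOn fun n F hF hFdep => ?_
    have hFc := hF.comp hc
    simp only [Function.comp_def] at hFc
    rw [lintegral_map hF hc, lintegral_map hF hc, Measure.lintegral_bind κ.aemeasurable
      hFc.aemeasurable]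
    simp_rw [hκG _ hFc]
    refine lintegral_eq_resample_of_finite s x n hFc fun s w w' h => ?_
    refine hFdep _ fun y hy => ?_
    split_ifs with hy'
    · exact h y ⟨Nat.le_of_lt hy, hy'⟩
    · rfl
  have h1 : ∀ μ : Measure (Population S L), ∫⁻ ω, G ω ∂μ = ∫⁻ ω, G ω ∂(μ.map c) := fun μ => by
    rw [lintegral_map hG hc]
    simp_rw [c, hdep.apply_cutLives]
  rw [h1, key, ← h1, Measure.lintegral_bind κ.aemeasurable hG.aemeasurable]
  simp_rw [hκG _ hG]

/-- The lives of `x` and its descendants. -/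
def subLives (x : Individual) (ω : Population S L) : Individual → L := fun m => ω.2 (m ++ x)

/-- The population stemming from `x`. -/
def LifeSpace.subPop (D : LifeSpace S L) (x : Individual) (ω : Population S L) : Population S L :=
  (D.type ω x, subLives x ω)

@[fun_prop]
theorem measurable_subLives (x : Individual) : Measurable (subLives (S := S) (L := L) x) := by
  unfold subLives; fun_prop

@[fun_prop]
theorem LifeSpace.measurable_subPop (D : LifeSpace S L) (x : Individual) :
    Measurable (D.subPop x) := by
  unfold LifeSpace.subPop; fun_prop

theorem LifeSpace.type_subPop (D : LifeSpace S L) (x m : Individual) (ω : Population S L) :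
    D.type (D.subPop x ω) m = D.type ω (m ++ x) := by
  cases m <;> rfl

theorem lintegral_popLaw_fst (s : S) {G : Population S L → ℝ≥0∞} (hG : Measurable G) :
    ∫⁻ ω, G ω ∂popLaw D P s = ∫⁻ ω, G (s, ω.2) ∂popLaw D P s := by
  rw [lintegral_popLaw s hG, lintegral_popLaw s (by fun_prop)]

theorem DependsOnLives.type (x : Individual) :
    DependsOnLives (fun ω => D.type ω x) {y | ¬ x <:+ y} := fun s w w' h =>
  D.type_congr fun k m e => h m fun h' => by
    subst e
    exact absurd h'.length_le (by simp)

/-- Induction on the number of lives of the subtree that `H` may see. The last of them, `m`, is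
resampled on both sides: as `m ++ x` in the whole population and as `m` in the one started from
`σ_x`. Both draws use the same type, by `type_subPop`, so both sides reduce to the same functional
`H'` of fewer lives. -/
theorem lintegral_subLives_of_finite (s : S) (x : Individual) (n : ℕ)
    {H : Population S L × (Individual → L) → ℝ≥0∞} (hH : Measurable H)
    (hdep : ∀ v, DependsOnLives (fun ω => H (ω, v)) {y | ¬ x <:+ y})
    (hdep' : ∀ ω, DependsOn (fun v => H (ω, v)) {m | encode m < n}) :
    ∫⁻ ω, H (ω, subLives x ω) ∂popLaw D P s
      = ∫⁻ ω, ∫⁻ ω', H (ω, ω'.2) ∂popLaw D P (D.type ω x) ∂popLaw D P s := by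
  induction n generalizing H with
  | zero =>
    obtain ⟨w₀⟩ := nonempty_lives P s
    have : ∀ ω v, H (ω, v) = H (ω, w₀) := fun ω v => hdep' ω (by simp)
    simp_rw [this]
    simp
  | succ n ih =>
    let m : Individual := Denumerable.ofNat _ n
    have hm : encode m = n := Denumerable.encode_ofNat _
    let H' : Population S L × (Individual → L) → ℝ≥0∞ := fun p =>
      ∫⁻ l, H (p.1, Function.update p.2 m l) ∂P (D.type (D.type p.1 x, p.2) m)
    have hT : Measurable fun p : Population S L × (Individual → L) =>
        D.type (D.type p.1 x, p.2) m :=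
      (D.measurable_type m).comp (((D.measurable_type x).comp measurable_fst).prodMk measurable_snd)
    have hU : Measurable fun p : (Population S L × (Individual → L)) × L =>
        (p.1.1, Function.update p.1.2 m p.2) := by
      refine measurable_fst.fst.prodMk (measurable_pi_iff.2 fun y => ?_)
      by_cases h : y = m
      · subst h; simpa using measurable_snd
      · simp only [Function.update_of_ne h]; fun_prop
    have hH' : Measurable H' :=
      Measurable.lintegral_kernel_prod_right' (κ := P.comap _ hT) (hH.comp hU)
    have hG : Measurable fun ω => H (ω, subLives x ω) := by fun_prop
    rw [lintegral_eq_resample s (m ++ x) hG]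
    · have h1 : ∀ ω, resample D P (m ++ x) (fun ω => H (ω, subLives x ω)) ω
          = H' (ω, subLives x ω) := by
        rintro ⟨s', w⟩
        have : D.type (s', w) (m ++ x) = D.type (D.type (s', w) x, subLives x (s', w)) m :=
          (D.type_subPop x m _).symm
        simp only [resample, H', this]
        refine lintegral_congr fun l => ?_
        have e : subLives x ((s', Function.update w (m ++ x) l) : Population S L)
            = Function.update (subLives x (s', w)) m l := by
          ext m'
          by_cases h : m' = m
          · subst h; simp [subLives]
          · have : m' ++ x ≠ m ++ x := fun e => h (List.append_cancel_right e)
            simp [subLives, Function.update_of_ne h, Function.update_of_ne this]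
        rw [e]
        refine hdep _ fun y hy => Function.update_of_ne ?_ _ _
        rintro rfl
        exact hy (List.suffix_append _ _)
      simp_rw [h1]
      rw [ih hH']
      · refine lintegral_congr fun ω => ?_
        set r := D.type ω x
        rw [lintegral_popLaw_eq_resample_of_encode_le r m (G := fun ω' => H (ω, ω'.2))
          (by fun_prop), lintegral_popLaw_fst r (measurable_resample m (by fun_prop))]
        · rfl
        · intro s' v v' h
          exact hdep' ω fun y hy => h y (by simp only [Set.mem_ofPred_eq] at hy ⊢; omega)
      · intro v s' w w' h
        simp only [H']
        rw [show D.type (s', w) x = D.type (s', w') x from DependsOnLives.type x h]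
        exact lintegral_congr fun l => hdep _ h
      · intro ω v v' h
        simp only [H']
        rw [D.type_congr (w' := v') (fun k m' e => h m' ?_)]
        · refine lintegral_congr fun l => hdep' ω fun y hy => ?_
          by_cases hym : y = m
          · subst hym; simp
          · rw [Function.update_of_ne hym, Function.update_of_ne hym]
            refine h y ?_
            have : encode y ≠ n := fun e => hym (encode_injective (e.trans hm.symm))
            simp only [Set.mem_ofPred_eq] at hy ⊢; omega
        · have := encode_lt_encode_cons k m'
          rw [← e, hm] at this
          exact this
    · intro s' w w' h
      have hw : ∀ y ∈ {y | ¬ x <:+ y}, w y = w' y := fun y hy => h y fun hy' =>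
        absurd ((List.suffix_append _ _).trans hy') hy
      simp only
      rw [show H ((s', w), subLives x (s', w)) = H ((s', w'), subLives x (s', w)) from hdep _ hw]
      -- Descendants have larger numbers, so the only individual of the subtree that `H` sees and
      -- that stems from `m` is `m` itself.
      refine hdep' _ fun m' hm' => h _ fun hs => ?_
      obtain ⟨u, hu⟩ := hs
      rw [← List.append_assoc] at hu
      have hu := List.append_cancel_right hu
      have h2 := encode_le_encode_append u m
      rw [hu, hm] at h2
      have : encode m' = n := by simp only [Set.mem_ofPred_eq] at hm'; omega
      rw [encode_injective (this.trans hm.symm)]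

/-- The population stemming from `x`, given the lives of all individuals not stemming from `x`, has
law `ℙ_{σ_x}`. -/
theorem lintegral_subLives (s : S) (x : Individual)
    {H : Population S L × (Individual → L) → ℝ≥0∞} (hH : Measurable H)
    (hdep : ∀ v, DependsOnLives (fun ω => H (ω, v)) {y | ¬ x <:+ y}) :
    ∫⁻ ω, H (ω, subLives x ω) ∂popLaw D P s
      = ∫⁻ ω, ∫⁻ ω', H (ω, ω'.2) ∂popLaw D P (D.type ω x) ∂popLaw D P s := by
  obtain ⟨w₀⟩ := nonempty_lives P s
  let c := cutLives (S := S) {y | ¬ x <:+ y} w₀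
  have hc : Measurable c := measurable_cutLives _ _
  let κ := (popLaw D P).comap (fun ω : Population S L => D.type ω x) (D.measurable_type x)
  let μ₁ := (popLaw D P s).map fun ω => (c ω, subLives x ω)
  let μ₂ := (popLaw D P s ⊗ₘ κ).map fun p => (c p.1, p.2.2)
  have e₁ : ∀ F : Population S L × (Individual → L) → ℝ≥0∞, Measurable F →
      ∫⁻ p, F p ∂μ₁ = ∫⁻ ω, F (c ω, subLives x ω) ∂popLaw D P s := fun F hF => by
    rw [lintegral_map hF (by fun_prop)]
  have e₂ : ∀ F : Population S L × (Individual → L) → ℝ≥0∞, Measurable F →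
      ∫⁻ p, F p ∂μ₂ = ∫⁻ ω, ∫⁻ ω', F (c ω, ω'.2) ∂popLaw D P (D.type ω x) ∂popLaw D P s :=
    fun F hF => by
      rw [lintegral_map hF (by fun_prop), Measure.lintegral_compProd (by fun_prop)]
      rfl
  have hμ : IsFiniteMeasure μ₁ := by infer_instance
  have key : μ₁ = μ₂ := by
    -- The first factor is now the whole cut population; only the subtree is restricted to finitely
    -- many lives.
    refine measure_ext_of_dependsOn fun n F hF hFdep => ?_
    rw [e₁ F hF, e₂ F hF]
    refine lintegral_subLives_of_finite (H := fun p => F (c p.1, p.2)) s x n (by fun_prop) ?_ ?_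
    · exact fun v => (dependsOnLives_cutLives _ w₀).comp fun ω => F (ω, v)
    · exact fun ω => hFdep (c ω)
  have h3 : ∀ ω v, H (c ω, v) = H (ω, v) := fun ω v => (hdep v).apply_cutLives w₀ ω
  have := congrArg (fun μ => ∫⁻ p, H p ∂μ) key
  simp only [e₁ H hH, e₂ H hH, h3] at this
  exact this

end Branching
end

/-! ### Exponential weights of a generation. -/

noncomputable section

namespace Branching

open Encodable

/-- `exp (-a)` for `a ∈ [0, ∞]`. -/
def expNeg (a : ℝ≥0∞) : ℝ≥0∞ := EReal.exp (-(a : EReal))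

/-- `- log a ∈ [0, ∞]` for `a ∈ [0, 1]`. -/
def negLog (a : ℝ≥0∞) : ℝ≥0∞ := (-ENNReal.log a).toENNReal

theorem continuous_expNeg : Continuous expNeg :=
  ENNReal.continuous_exp.comp (continuous_neg.comp continuous_coe_ennreal_ereal)

theorem antitone_expNeg : Antitone expNeg := fun _ _ h =>
  EReal.exp_monotone (EReal.neg_le_neg_iff.2 (EReal.coe_ennreal_le_coe_ennreal_iff.2 h))

@[simp]
theorem expNeg_zero : expNeg 0 = 1 := by simp [expNeg]

@[simp]
theorem expNeg_top : expNeg ∞ = 0 := by simp [expNeg]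

theorem expNeg_add (a b : ℝ≥0∞) : expNeg (a + b) = expNeg a * expNeg b := by
  rw [expNeg, expNeg, expNeg, ← EReal.exp_add, EReal.coe_ennreal_add, EReal.neg_add,
    sub_eq_add_neg] <;> simp

theorem expNeg_sum {ι : Type*} (s : Finset ι) (f : ι → ℝ≥0∞) :
    expNeg (∑ i ∈ s, f i) = ∏ i ∈ s, expNeg (f i) := by
  classical
  induction s using Finset.induction_on with
  | empty => simp
  | insert a s ha ih => rw [Finset.sum_insert ha, Finset.prod_insert ha, expNeg_add, ih]

theorem expNeg_iSup {ι : Type*} [Nonempty ι] (f : ι → ℝ≥0∞) :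
    expNeg (⨆ i, f i) = ⨅ i, expNeg (f i) :=
  antitone_expNeg.map_ciSup_of_continuousAt continuous_expNeg.continuousAt (OrderTop.bddAbove _)

theorem expNeg_negLog {a : ℝ≥0∞} (ha : a ≤ 1) : expNeg (negLog a) = a := by
  have h : (0 : EReal) ≤ -ENNReal.log a := by
    rw [EReal.neg_nonneg, ← ENNReal.log_one]
    exact ENNReal.log_monotone ha
  rw [expNeg, negLog, EReal.coe_toENNReal h, neg_neg, ENNReal.exp_log]

theorem antitone_negLog : Antitone negLog := fun _ _ h =>
  EReal.toENNReal_le_toENNReal (EReal.neg_le_neg_iff.2 (ENNReal.log_monotone h))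

theorem measurable_negLog : Measurable negLog :=
  (ENNReal.measurable_log.neg).ereal_toENNReal

/-- Writing `∞` as the supremum of the naturals, the continuous decreasing exponential turns it into
the infimum of the powers; `0 * ∞ = 0` matches `1 ^ ∞ = 1`. Monotonicity in base and exponent can
then be read off. -/
theorem powENat_eq_expNeg {a : ℝ≥0∞} (ha : a ≤ 1) (m : ℕ∞) :
    powENat a m = expNeg (negLog a * m) := by
  have h : ∀ k : ℕ, a ^ k = expNeg (negLog a * k) := fun k => by
    have := expNeg_sum (Finset.range k) fun _ => negLog a
    simp only [Finset.sum_const, Finset.card_range, Finset.prod_const, expNeg_negLog ha,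
      nsmul_eq_mul] at this
    rw [← this, mul_comm]
  cases m with
  | top =>
    have : ((⊤ : ℕ∞) : ℝ≥0∞) = ⨆ k : ℕ, (k : ℝ≥0∞) := by
      rw [ENNReal.iSup_natCast]; simp
    change ⨅ k : ℕ, a ^ k = _
    rw [this, ENNReal.mul_iSup, expNeg_iSup]
    simp_rw [h]
  | coe k => exact h k

theorem powENat_antitone {a : ℝ≥0∞} (ha : a ≤ 1) : Antitone (powENat a) := fun m k h => by
  rw [powENat_eq_expNeg ha, powENat_eq_expNeg ha]
  exact antitone_expNeg (by gcongr)

theorem powENat_zero (a : ℝ≥0∞) : powENat a 0 = 1 := pow_zero a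

theorem powENat_le_one {a : ℝ≥0∞} (ha : a ≤ 1) (m : ℕ∞) : powENat a m ≤ 1 :=
  (powENat_antitone ha (zero_le (a := m))).trans (powENat_zero a).le

theorem powENat_top {a : ℝ≥0∞} (ha : a < 1) : powENat a ⊤ = 0 := by
  have h : negLog a ≠ 0 := fun h => by
    have := expNeg_negLog ha.le
    rw [h, expNeg_zero] at this
    exact ha.ne this.symm
  rw [powENat_eq_expNeg ha.le, ENat.toENNReal_top, ENNReal.mul_top h, expNeg_top]

theorem one_powENat (m : ℕ∞) : powENat 1 m = 1 := by
  cases m with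
  | top => change ⨅ k : ℕ, (1 : ℝ≥0∞) ^ k = 1; simp
  | coe k => exact one_pow k

/-- The individuals of generation `n` with number less than `M`. -/
def level (n M : ℕ) : Finset Individual :=
  ((Finset.range M).image (Denumerable.ofNat Individual)).filter fun x => x.length = n

theorem mem_level {n M : ℕ} {x : Individual} : x ∈ level n M ↔ x.length = n ∧ encode x < M := by
  simp only [level, Finset.mem_filter, Finset.mem_image, Finset.mem_range]
  constructor
  · rintro ⟨⟨k, hk, rfl⟩, h⟩
    exact ⟨h, by simpa using hk⟩
  · rintro ⟨h, hM⟩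
    exact ⟨⟨_, hM, Denumerable.ofNat_encode x⟩, h⟩

theorem monotone_level (n : ℕ) : Monotone (level n) := fun _ _ h _ hx =>
  mem_level.2 ⟨(mem_level.1 hx).1, (mem_level.1 hx).2.trans_le h⟩

@[simp]
theorem level_zero (n : ℕ) : level n 0 = ∅ := by ext x; simp [mem_level]

variable {S L : Type*} [MeasurableSpace S] [MeasurableSpace L] (D : LifeSpace S L)

theorem measurable_indicator_realised (x : Individual) {f : Population S L → ℝ≥0∞}
    (hf : Measurable f) : Measurable fun ω => (D.realised ω).indicator (fun _ => f ω) x := by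
  have : (fun ω => (D.realised ω).indicator (fun _ => f ω) x)
      = {ω | D.birthTime ω x < ∞}.indicator f := by
    ext ω; by_cases h : D.birthTime ω x < ∞ <;> simp [Set.indicator, LifeSpace.realised, h]
  rw [this]
  exact hf.indicator (measurableSet_lt (D.measurable_birthTime x) measurable_const)

theorem measurable_mulIndicator_realised (x : Individual) {f : Population S L → ℝ≥0∞}
    (hf : Measurable f) : Measurable fun ω => (D.realised ω).mulIndicator (fun _ => f ω) x := by
  classical
  have : (fun ω => (D.realised ω).mulIndicator (fun _ => f ω) x)
      = fun ω => if D.birthTime ω x < ∞ then f ω else 1 := by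
    ext ω; by_cases h : D.birthTime ω x < ∞ <;> simp [Set.mulIndicator, LifeSpace.realised, h]
  rw [this]
  exact Measurable.ite (measurableSet_lt (D.measurable_birthTime x) measurable_const) hf
    measurable_const

theorem measurableSet_extinction : MeasurableSet (D.extinction : Set (Population S L)) := by
  have : (D.extinction : Set (Population S L))
      = ⋃ T : Finset Individual, ⋂ x, ⋂ _ : x ∉ T, {ω | ¬ D.birthTime ω x < ∞} := by
    ext ω
    simp only [LifeSpace.extinction, LifeSpace.realised, Set.mem_iUnion, Set.mem_iInter,
      Set.mem_ofPred_eq]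
    constructor
    · intro h
      exact ⟨h.toFinset, fun x hx h' => hx (h.mem_toFinset.2 h')⟩
    · rintro ⟨T, hT⟩
      exact T.finite_toSet.subset fun _ hx => by_contra fun h => hT _ h hx
  rw [this]
  exact .iUnion fun T => .iInter fun x => .iInter fun _ =>
    (measurableSet_lt (D.measurable_birthTime x) measurable_const).compl

/-- Exhausting the generation by the finite sets `level n M` gives measurability and reduces
infinite generations to finite sums. -/
theorem lintegral_genMeasure (n : ℕ) (ω : Population S L) {φ : S → ℝ≥0∞} (hφ : Measurable φ) :
    ∫⁻ r, φ r ∂D.genMeasure n ω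
      = ⨆ M, ∑ x ∈ level n M, (D.realised ω).indicator (fun x => φ (D.type ω x)) x := by
  rw [LifeSpace.genMeasure, lintegral_sum_measure]
  simp_rw [lintegral_dirac' _ hφ]
  rw [tsum_subtype (D.generation n ω) fun x => φ (D.type ω x),
    ENNReal.tsum_eq_iSup_sum' fun M => (Finset.range M).image (Denumerable.ofNat Individual)]
  · congr with M
    rw [level, Finset.sum_filter]
    refine Finset.sum_congr rfl fun x _ => ?_
    by_cases h : x.length = n <;> by_cases h' : x ∈ D.realised ω <;>
      simp [LifeSpace.generation, Set.indicator, h, h']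
  · intro t
    refine ⟨t.sup encode + 1, fun x hx => Finset.mem_image.2 ⟨encode x, ?_, ?_⟩⟩
    · exact Finset.mem_range.2 (Nat.lt_succ_of_le (Finset.le_sup (f := encode) hx))
    · exact Denumerable.ofNat_encode x

@[fun_prop]
theorem measurable_lintegral_genMeasure (n : ℕ) {φ : S → ℝ≥0∞} (hφ : Measurable φ) :
    Measurable fun ω : Population S L => ∫⁻ r, φ r ∂D.genMeasure n ω := by
  simp_rw [lintegral_genMeasure D n _ hφ]
  exact .iSup fun M => Finset.measurable_sum _ fun x _ =>
    measurable_indicator_realised D x (hφ.comp (D.measurable_type x))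

theorem genSize_eq_lintegral (n : ℕ) (ω : Population S L) :
    (D.genSize n ω : ℝ≥0∞) = ∫⁻ _, 1 ∂D.genMeasure n ω := by
  rw [lintegral_one, D.genMeasure_apply n ω .univ]; rfl

@[fun_prop]
theorem measurable_genSize (n : ℕ) : Measurable (D.genSize n : Population S L → ℕ∞) := by
  have h : Measurable fun ω : Population S L => (D.genSize n ω : ℝ≥0∞) := by
    simp_rw [genSize_eq_lintegral]; fun_prop
  refine measurable_to_countable' fun k => ?_
  have : (D.genSize n : Population S L → ℕ∞) ⁻¹' {k}
      = (fun ω => (D.genSize n ω : ℝ≥0∞)) ⁻¹' {(k : ℝ≥0∞)} := by ext ω; simp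
  rw [this]
  exact h (measurableSet_singleton _)

/-- `exp (∫ log q_r X_n(dr))` for a function `q` on the type space with values in `[0, 1]`. -/
def genWeight (n : ℕ) (q : S → ℝ≥0∞) (ω : Population S L) : ℝ≥0∞ :=
  expNeg (∫⁻ r, negLog (q r) ∂D.genMeasure n ω)

@[fun_prop]
theorem measurable_genWeight (n : ℕ) {q : S → ℝ≥0∞} (hq : Measurable q) :
    Measurable (genWeight D n q) :=
  continuous_expNeg.measurable.comp
    (measurable_lintegral_genMeasure D n (measurable_negLog.comp hq))

/-- The exponential turns increasing sums into decreasing products; unrealised individuals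
contribute the factor `1`, hence `mulIndicator`. -/
theorem genWeight_eq_iInf (n : ℕ) {q : S → ℝ≥0∞} (hq : Measurable q) (hq1 : ∀ r, q r ≤ 1)
    (ω : Population S L) :
    genWeight D n q ω
      = ⨅ M, ∏ x ∈ level n M, (D.realised ω).mulIndicator (fun x => q (D.type ω x)) x := by
  rw [genWeight, lintegral_genMeasure D n ω (φ := fun r => negLog (q r))
    (measurable_negLog.comp hq), expNeg_iSup]
  congr with M
  rw [expNeg_sum]
  refine Finset.prod_congr rfl fun x _ => ?_
  by_cases h : x ∈ D.realised ω <;> simp [h, expNeg_negLog (hq1 _)]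

theorem genWeight_mono (n : ℕ) {q q' : S → ℝ≥0∞} (h : ∀ r, q r ≤ q' r) (ω : Population S L) :
    genWeight D n q ω ≤ genWeight D n q' ω :=
  antitone_expNeg (lintegral_mono fun r => antitone_negLog (h r))

theorem genWeight_const (n : ℕ) {a : ℝ≥0∞} (ha : a ≤ 1) (ω : Population S L) :
    genWeight D n (fun _ => a) ω = powENat a (D.genSize n ω) := by
  rw [powENat_eq_expNeg ha, genWeight, lintegral_const, D.genMeasure_apply n ω .univ]
  rfl

end Branching
end

/-! ### The branching property for a whole generation. -/

noncomputable section

namespace Branching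

open Encodable

section

variable {S L : Type*} [MeasurableSpace S] [MeasurableSpace L] {D : LifeSpace S L}

theorem DependsOnLives.birthTime (x : Individual) :
    DependsOnLives (fun ω => D.birthTime ω x) {y | y.length < x.length} := by
  intro s w w' h
  induction x with
  | nil => rfl
  | cons k m ih =>
    have := ih fun y hy => h y (Nat.lt_succ_of_lt hy)
    simp only [LifeSpace.birthTime] at this ⊢
    rw [this, h m (by simp)]

theorem DependsOnLives.type_length (x : Individual) :
    DependsOnLives (fun ω => D.type ω x) {y | y.length < x.length} := fun _ _ _ h =>
  D.type_congr fun k m e => h m (by simp [e])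

theorem DependsOnLives.mem_realised (x : Individual) :
    DependsOnLives (fun ω => x ∈ D.realised ω) {y | y.length < x.length} :=
  (DependsOnLives.birthTime x).comp fun t => t < ∞

theorem DependsOnLives.genSize (n : ℕ) :
    DependsOnLives (D.genSize n) {y | y.length < n} := by
  intro s w w' h
  have : D.generation n (s, w) = D.generation n (s, w') := by
    ext x
    refine and_congr_right fun hx => ?_
    subst hx
    exact iff_of_eq (DependsOnLives.mem_realised x h)
  simp only [LifeSpace.genSize, LifeSpace.genCount, Set.mem_univ, and_true, this]

theorem DependsOnLives.mulIndicator_realised {x : Individual} {A : Set Individual}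
    (hA : {y : Individual | y.length < x.length} ⊆ A)
    {f : Population S L → ℝ≥0∞} (hf : DependsOnLives f A) :
    DependsOnLives (fun ω => (D.realised ω).mulIndicator (fun _ => f ω) x) A := by
  classical
  intro s w w' h
  have := (DependsOnLives.mem_realised (D := D) x).mono hA (s := s) h
  simp only [Set.mulIndicator_apply, hf h, eq_iff_iff] at this ⊢
  simp only [this]

end

section

variable {S L : Type*}

theorem DependsOnLives.mul {f g : Population S L → ℝ≥0∞} {A : Set Individual}
    (hf : DependsOnLives f A) (hg : DependsOnLives g A) :
    DependsOnLives (fun ω => f ω * g ω) A := fun s w w' h => by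
  simp only [hf h, hg h]

theorem DependsOnLives.prod {ι : Type*} {f : ι → Population S L → ℝ≥0∞} {A : Set Individual}
    (T : Finset ι) (hf : ∀ i ∈ T, DependsOnLives (f i) A) :
    DependsOnLives (fun ω => ∏ i ∈ T, f i ω) A := fun _ _ _ h =>
  Finset.prod_congr rfl fun i hi => hf i hi h

end

variable {S L : Type*} [MeasurableSpace S] [MeasurableSpace L] {D : LifeSpace S L}
  {P : Kernel S L} [IsMarkovKernel P]

/-- Peel off one `x` of `T`. Distinct members of one generation have disjoint progenies, so `g` and
the other factors do not involve the lives stemming from `x`, and `lintegral_subLives` integrates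
its factor. The result depends only on lives before generation `n` and is absorbed into `g`. -/
theorem lintegral_prod_subPop (s : S) {n : ℕ} {T : Finset Individual} (hT : ∀ x ∈ T, x.length = n)
    {f : Population S L → ℝ≥0∞} (hf : Measurable f) {g : Population S L → ℝ≥0∞}
    (hg : Measurable g) (hdep : DependsOnLives g {y | y.length < n}) :
    ∫⁻ ω, g ω * ∏ x ∈ T, (D.realised ω).mulIndicator (fun x => f (D.subPop x ω)) x ∂popLaw D P s
      = ∫⁻ ω, g ω * ∏ x ∈ T, (D.realised ω).mulIndicator
          (fun x => ∫⁻ ω', f ω' ∂popLaw D P (D.type ω x)) x ∂popLaw D P s := by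
  induction T using Finset.induction_on generalizing g with
  | empty => simp
  | insert x T hx ih =>
    have hxn : x.length = n := hT x (Finset.mem_insert_self _ _)
    have hTn : ∀ y ∈ T, y.length = n := fun y hy => hT y (Finset.mem_insert_of_mem hy)
    have hsub : {y : Individual | y.length < n} ⊆ {y | ¬ x <:+ y} := fun y hy h =>
      absurd h.length_le (by rw [hxn]; exact not_le.2 hy)
    let a : Population S L → ℝ≥0∞ := fun ω =>
      ∏ y ∈ T, (D.realised ω).mulIndicator (fun y => f (D.subPop y ω)) y
    let b : Population S L → ℝ≥0∞ := fun ω =>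
      (D.realised ω).mulIndicator (fun x => ∫⁻ ω', f ω' ∂popLaw D P (D.type ω x)) x
    have ha : Measurable a := Finset.measurable_prod _ fun y _ =>
      measurable_mulIndicator_realised D y (hf.comp (D.measurable_subPop y))
    have hq : Measurable fun r => ∫⁻ ω', f ω' ∂popLaw D P r := hf.lintegral_kernel
    have hb : Measurable b :=
      measurable_mulIndicator_realised D x (hq.comp (D.measurable_type x))
    have hadep : DependsOnLives a {y | ¬ x <:+ y} := by
      refine DependsOnLives.prod T fun y hy => DependsOnLives.mulIndicator_realised
        (by rw [hTn y hy]; exact hsub) (f := fun ω => f (D.subPop y ω)) ?_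
      refine DependsOnLives.comp (G := D.subPop y) ?_ f
      intro s w w' h
      refine Prod.ext ?_ (funext fun m => h _ fun hs => ?_)
      · exact (DependsOnLives.type_length y).mono (by rw [hTn y hy]; exact hsub) h
      · obtain ⟨u, hu⟩ := hs
        have := (List.append_inj' hu (by rw [hxn, hTn y hy])).2
        exact hx (this ▸ hy)
    let H : Population S L × (Individual → L) → ℝ≥0∞ := fun p =>
      g p.1 * a p.1 * (D.realised p.1).mulIndicator (fun _ => f (D.type p.1 x, p.2)) x
    have hind : Measurable fun p : Population S L × (Individual → L) =>
        (D.realised p.1).mulIndicator (fun _ => f (D.type p.1 x, p.2)) x := by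
      have : (fun p : Population S L × (Individual → L) =>
          (D.realised p.1).mulIndicator (fun _ => f (D.type p.1 x, p.2)) x)
          = fun p => if D.birthTime p.1 x < ∞ then f (D.type p.1 x, p.2) else 1 := by
        ext p
        by_cases h : D.birthTime p.1 x < ∞ <;> simp [Set.mulIndicator, LifeSpace.realised, h]
      rw [this]
      refine Measurable.ite (measurableSet_lt ((D.measurable_birthTime x).comp measurable_fst)
        measurable_const) (hf.comp ?_) measurable_const
      exact ((D.measurable_type x).comp measurable_fst).prodMk measurable_snd
    have hH : Measurable H := ((hg.comp measurable_fst).mul (ha.comp measurable_fst)).mul hind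
    have h1 := lintegral_subLives (D := D) (P := P) s x hH fun v => by
      refine ((hdep.mono hsub).mul hadep).mul (DependsOnLives.mulIndicator_realised
        (by rw [hxn]; exact hsub) (f := fun ω => f (D.type ω x, v)) ?_)
      exact (DependsOnLives.type x).comp fun r => f (r, v)
    have h2 : ∀ ω, ∫⁻ ω', H (ω, ω'.2) ∂popLaw D P (D.type ω x) = (g ω * b ω) * a ω := by
      intro ω
      simp only [H]
      rw [lintegral_const_mul (f := fun ω' : Population S L =>
        (D.realised ω).mulIndicator (fun _ => f (D.type ω x, ω'.2)) x) _
        (hind.comp (by fun_prop : Measurable fun ω' : Population S L => (ω, ω'.2)))]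
      have : ∫⁻ ω' : Population S L, (D.realised ω).mulIndicator
          (fun _ => f (D.type ω x, ω'.2)) x ∂popLaw D P (D.type ω x) = b ω := by
        by_cases h : x ∈ D.realised ω
        · simp only [b, Set.mulIndicator_of_mem h]
          exact (lintegral_popLaw_fst _ hf).symm
        · simp [b, Set.mulIndicator_of_notMem h]
      rw [this]; ring
    have h3 := ih hTn (g := fun ω => g ω * b ω) (hg.mul hb) (hdep.mul
      (DependsOnLives.mulIndicator_realised (by rw [hxn])
        (f := fun ω => ∫⁻ ω', f ω' ∂popLaw D P (D.type ω x)) <| by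
        have := DependsOnLives.type_length (D := D) x
        rw [hxn] at this
        exact this.comp fun r => ∫⁻ ω', f ω' ∂popLaw D P r))
    simp_rw [h2] at h1
    simp_rw [Finset.prod_insert hx]
    calc _ = ∫⁻ ω, H (ω, subLives x ω) ∂popLaw D P s := by
          refine lintegral_congr fun ω => ?_
          simp only [H, a, LifeSpace.subPop, Set.mulIndicator]
          ring
      _ = _ := h1
      _ = _ := h3
      _ = _ := by
          refine lintegral_congr fun ω => ?_
          simp only [b]
          ring

variable (D) in
/-- The event that the populations stemming from all individuals of generation `n` are in `F`. -/
def LifeSpace.subPopsIn (n : ℕ) (F : Set (Population S L)) : Set (Population S L) :=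
  {ω | ∀ x ∈ D.generation n ω, D.subPop x ω ∈ F}

/-- The counterpart of `genWeight_eq_iInf`, so that the two sides can be compared level by level. -/
theorem indicator_subPopsIn (n : ℕ) (F : Set (Population S L)) (ω : Population S L) :
    (D.subPopsIn n F).indicator 1 ω = ⨅ M, ∏ x ∈ level n M,
      (D.realised ω).mulIndicator (fun x => F.indicator (1 : Population S L → ℝ≥0∞) (D.subPop x ω)) x := by
  by_cases h : ω ∈ D.subPopsIn n F
  · rw [Set.indicator_of_mem h]
    have : ∀ M, ∏ x ∈ level n M, (D.realised ω).mulIndicator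
        (fun x => F.indicator (1 : Population S L → ℝ≥0∞) (D.subPop x ω)) x = 1 := fun M => by
      refine Finset.prod_eq_one fun x hx => ?_
      by_cases hr : x ∈ D.realised ω
      · rw [Set.mulIndicator_of_mem hr, Set.indicator_of_mem (h x ⟨(mem_level.1 hx).1, hr⟩)]; rfl
      · exact Set.mulIndicator_of_notMem hr _
    simp [this]
  · rw [Set.indicator_of_notMem h]
    simp only [LifeSpace.subPopsIn, Set.mem_ofPred_eq, not_forall] at h
    obtain ⟨x, hx, hxF⟩ := h
    refine le_antisymm (zero_le (a := _)) ((iInf_le _ (encode x + 1)).trans ?_)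
    refine (Finset.prod_eq_zero (mem_level.2 ⟨hx.1, Nat.lt_succ_self _⟩) ?_).le
    rw [Set.mulIndicator_of_mem hx.2, Set.indicator_of_notMem hxF]

theorem prod_level_antitone {n : ℕ} {ω : Population S L} {a : Individual → ℝ≥0∞}
    (ha : ∀ x, a x ≤ 1) : Antitone fun M => ∏ x ∈ level n M, (D.realised ω).mulIndicator a x := by
  refine fun M N h => Finset.prod_le_prod_of_subset_of_le_one' (monotone_level n h)
    fun x _ _ => ?_
  by_cases hr : x ∈ D.realised ω
  · rw [Set.mulIndicator_of_mem hr]; exact ha x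
  · rw [Set.mulIndicator_of_notMem hr]

theorem measurableSet_subPopsIn (n : ℕ) {F : Set (Population S L)} (hF : MeasurableSet F) :
    MeasurableSet (D.subPopsIn n F) := by
  have : D.subPopsIn n F = ⋂ x : Individual, ⋂ _ : x.length = n,
      {ω | D.birthTime ω x < ∞}ᶜ ∪ D.subPop x ⁻¹' F := by
    ext ω
    simp only [LifeSpace.subPopsIn, LifeSpace.generation, LifeSpace.realised, Set.mem_iInter,
      Set.mem_ofPred_eq, Set.mem_inter_iff, and_imp, Set.mem_union, Set.mem_compl_iff,
      Set.mem_preimage]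
    exact forall_congr' fun x => imp_congr_right fun _ => imp_iff_not_or
  rw [this]
  exact .iInter fun x => .iInter fun _ =>
    (measurableSet_lt (D.measurable_birthTime x) measurable_const).compl.union
      (D.measurable_subPop x hF)

/-- The finite products decrease to their limits, and decreasing convergence needs a finite
integral: `g` is first truncated at `k`, and monotone convergence then removes the truncation. -/
theorem lintegral_mul_indicator_subPopsIn (s : S) (n : ℕ) {F : Set (Population S L)}
    (hF : MeasurableSet F) {g : Population S L → ℝ≥0∞}
    (hg : Measurable g) (hdep : DependsOnLives g {y | y.length < n}) :
    ∫⁻ ω, g ω * (D.subPopsIn n F).indicator 1 ω ∂popLaw D P s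
      = ∫⁻ ω, g ω * genWeight D n (fun r => popLaw D P r F) ω ∂popLaw D P s := by
  have hq : Measurable fun r => popLaw D P r F := (popLaw D P).measurable_coe hF
  have hW : Measurable ((D.subPopsIn n F).indicator (1 : Population S L → ℝ≥0∞)) :=
    measurable_one.indicator (measurableSet_subPopsIn n hF)
  have hbdd : ∀ k : ℕ, ∫⁻ ω, min (g ω) k * (D.subPopsIn n F).indicator 1 ω ∂popLaw D P s
      = ∫⁻ ω, min (g ω) k * genWeight D n (fun r => popLaw D P r F) ω ∂popLaw D P s := by
    intro k
    have hmin : ∀ ω, min (g ω) k ≠ ∞ := fun ω =>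
      ((min_le_right _ _).trans_lt (ENNReal.natCast_lt_top k)).ne
    have hgk : Measurable fun ω => min (g ω) (k : ℝ≥0∞) := hg.min measurable_const
    have hanti : ∀ a : Population S L → Individual → ℝ≥0∞, (∀ ω x, a ω x ≤ 1) →
        (∀ x, Measurable fun ω => a ω x) →
        ∫⁻ ω, min (g ω) k * ⨅ M, ∏ x ∈ level n M, (D.realised ω).mulIndicator (a ω) x
            ∂popLaw D P s
          = ⨅ M, ∫⁻ ω, min (g ω) k * ∏ x ∈ level n M, (D.realised ω).mulIndicator (a ω) x
            ∂popLaw D P s := by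
      intro a ha hma
      rw [← lintegral_iInf]
      · refine lintegral_congr fun ω => ?_
        rw [ENNReal.mul_iInf fun h => absurd h (hmin ω)]
      · exact fun M => hgk.mul (Finset.measurable_prod _ fun x _ =>
          measurable_mulIndicator_realised D x (hma x))
      · exact fun M N h ω => mul_le_mul_right (prod_level_antitone (ha ω) h) _
      · refine ne_top_of_le_ne_top (b := ∫⁻ _, (k : ℝ≥0∞) ∂popLaw D P s) (by simp)
          (lintegral_mono fun ω => ?_)
        simp
    simp_rw [indicator_subPopsIn, genWeight_eq_iInf D n hq fun r => prob_le_one]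
    rw [hanti (fun ω x => F.indicator 1 (D.subPop x ω))
        (fun ω x => Set.indicator_le_self' (by simp) _),
      hanti (fun ω x => popLaw D P (D.type ω x) F) (fun ω x => prob_le_one)]
    · congr with M
      have := lintegral_prod_subPop (D := D) (P := P) s (T := level n M)
        (fun x hx => (mem_level.1 hx).1) (f := F.indicator 1) (measurable_one.indicator hF) hgk
        (hdep.comp fun t => min t (k : ℝ≥0∞))
      simpa only [lintegral_indicator_one hF] using this
    · exact fun x => hq.comp (D.measurable_type x)
    · exact fun x => (measurable_one.indicator hF).comp (D.measurable_subPop x)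
  have hsup : ∀ h : Population S L → ℝ≥0∞, Measurable h → ∫⁻ ω, g ω * h ω ∂popLaw D P s
      = ⨆ k : ℕ, ∫⁻ ω, min (g ω) k * h ω ∂popLaw D P s := by
    intro h hh
    rw [← lintegral_iSup]
    · refine lintegral_congr fun ω => ?_
      rw [← ENNReal.iSup_mul]
      congr 1
      rw [← inf_iSup_eq, ENNReal.iSup_natCast, inf_top_eq]
    · exact fun k => (hg.min measurable_const).mul hh
    · exact fun k l hkl ω => mul_le_mul_left (min_le_min le_rfl (by exact_mod_cast hkl)) _
  rw [hsup _ hW, hsup _ (measurable_genWeight D n hq)]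
  simp_rw [hbdd]

end Branching
end

/-! ### Extinction, the conditioned law and the dichotomy. -/

noncomputable section

namespace Branching

open Encodable

section

variable {S L : Type*} [MeasurableSpace S] [MeasurableSpace L] {D : LifeSpace S L}

theorem birthTime_append (ω : Population S L) (m x : Individual) :
    D.birthTime ω (m ++ x) = D.birthTime ω x + D.birthTime (D.subPop x ω) m := by
  induction m with
  | nil => simp [LifeSpace.birthTime]
  | cons k m ih =>
    simp only [List.cons_append, LifeSpace.birthTime, ih, add_assoc]
    rfl

theorem append_mem_realised {ω : Population S L} {m x : Individual} :
    m ++ x ∈ D.realised ω ↔ x ∈ D.realised ω ∧ m ∈ D.realised (D.subPop x ω) := by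
  simp [LifeSpace.realised, birthTime_append]

theorem subPop_nil (ω : Population S L) : D.subPop [] ω = ω := by
  refine Prod.ext rfl (funext fun m => ?_)
  simp [LifeSpace.subPop, subLives]

theorem extinction_subset_subPopsIn (n : ℕ) :
    (D.extinction : Set (Population S L)) ⊆ D.subPopsIn n D.extinction := by
  intro ω hω x hx
  refine Set.Finite.of_finite_image (f := (· ++ x)) (hω.subset ?_)
    fun _ _ _ _ h => List.append_cancel_right h
  rintro _ ⟨m, hm, rfl⟩
  exact append_mem_realised.2 ⟨hx.2, hm⟩

theorem subPopsIn_zero (F : Set (Population S L)) : D.subPopsIn 0 F = F := by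
  ext ω
  constructor
  · intro h
    have := h [] ⟨rfl, by simp [LifeSpace.realised, LifeSpace.birthTime]⟩
    rwa [subPop_nil] at this
  · rintro h x ⟨hx, -⟩
    rw [List.eq_nil_of_length_eq_zero hx, subPop_nil]
    exact h

theorem genSize_eq_encard (n : ℕ) (ω : Population S L) :
    D.genSize n ω = (D.generation n ω).encard := by
  simp [LifeSpace.genSize, LifeSpace.genCount]

/-- The progeny of `x` is `x` together with the progenies of its children, here finitely many finite
sets. -/
theorem mem_subPopsIn_of_succ {n : ℕ} {ω : Population S L}
    (h : ω ∈ D.subPopsIn (n + 1) D.extinction) (hfin : D.genSize (n + 1) ω ≠ ⊤) :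
    ω ∈ D.subPopsIn n D.extinction := by
  rintro x ⟨hx, hxr⟩
  rw [genSize_eq_encard, Set.encard_ne_top_iff] at hfin
  -- Appending `y.headI`, the rank of the child `y`, turns addresses relative to `y` into addresses
  -- relative to its mother.
  have hsub : D.realised (D.subPop x ω) ⊆ {[]} ∪ ⋃ y ∈ D.generation (n + 1) ω,
      (fun u => u ++ [y.headI]) '' D.realised (D.subPop y ω) := by
    intro m hm
    rcases List.eq_nil_or_concat m with rfl | ⟨u, k, rfl⟩
    · exact Or.inl rfl
    · have h1 : u ++ (k :: x) ∈ D.realised ω := by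
        simpa using append_mem_realised.2 ⟨hxr, hm⟩
      have h2 := append_mem_realised.1 h1
      refine Or.inr (Set.mem_iUnion₂.2 ⟨k :: x, ⟨congrArg (· + 1) hx, h2.1⟩, u, h2.2, by simp⟩)
  exact ((Set.finite_singleton _).union
    (hfin.biUnion fun y hy => (h y hy).image _)).subset hsub

theorem genSize_succ_eq_zero {n : ℕ} {ω : Population S L} (h : D.genSize n ω = 0) :
    D.genSize (n + 1) ω = 0 := by
  rw [genSize_eq_encard, Set.encard_eq_zero] at h ⊢
  refine Set.eq_empty_of_forall_notMem fun x hx => ?_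
  obtain ⟨hx, hr⟩ := hx
  cases x with
  | nil => simp at hx
  | cons k m =>
    have : m ∈ D.generation n ω := ⟨by simpa using hx, by
      have := (append_mem_realised (m := [k]) (x := m)).1 hr
      exact this.1⟩
    rw [h] at this
    exact this

theorem genSize_eq_zero_of_le {n m : ℕ} (hnm : n ≤ m) {ω : Population S L}
    (h : D.genSize n ω = 0) : D.genSize m ω = 0 := by
  induction m, hnm using Nat.le_induction with
  | base => exact h
  | succ m _ ih => exact genSize_succ_eq_zero ih

theorem exists_genSize_eq_zero {ω : Population S L} (h : ω ∈ D.extinction) :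
    ∃ n, D.genSize n ω = 0 := by
  have h : (D.realised ω).Finite := h
  refine ⟨h.toFinset.sup List.length + 1, ?_⟩
  rw [genSize_eq_encard, Set.encard_eq_zero]
  refine Set.eq_empty_of_forall_notMem fun x hx => ?_
  have h1 := Finset.le_sup (f := List.length) (h.mem_toFinset.2 hx.2)
  have h2 : x.length = _ := hx.1
  omega

theorem eventually_genSize_eq_zero {ω : Population S L} (h : ω ∈ D.extinction) :
    ∀ᶠ n in atTop, D.genSize n ω = 0 := by
  obtain ⟨n, hn⟩ := exists_genSize_eq_zero h
  exact eventually_atTop.2 ⟨n, fun m hm => genSize_eq_zero_of_le hm hn⟩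

end

theorem exists_mul_powENat_le {q : ℝ≥0∞} (hq : q < 1) {ε : ℝ≥0∞} (hε : 0 < ε) :
    ∃ K : ℕ, ∀ m : ℕ∞, (K : ℕ∞) ≤ m → (m : ℝ≥0∞) * powENat q m ≤ ε := by
  have h : Tendsto (fun k : ℕ => (k : ℝ≥0∞) * q ^ k) atTop (𝓝 0) := by
    lift q to NNReal using hq.ne_top
    have h1 := tendsto_self_mul_const_pow_of_lt_one q.2 (by exact_mod_cast hq)
    have h2 := ENNReal.tendsto_ofReal h1
    rw [ENNReal.ofReal_zero] at h2
    refine h2.congr fun k => ?_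
    rw [ENNReal.ofReal_mul (by positivity), ENNReal.ofReal_pow q.2]
    simp
  obtain ⟨K, hK⟩ := eventually_atTop.1 (ENNReal.tendsto_nhds_zero.1 h ε hε)
  refine ⟨K, fun m hm => ?_⟩
  cases m with
  | top => rw [powENat_top hq, mul_zero]; exact zero_le
  | coe k => exact hK k (by exact_mod_cast hm)

theorem exists_mul_powENat_le_nat {q : ℝ≥0∞} (hq : q < 1) :
    ∃ C : ℕ, ∀ m : ℕ∞, (m : ℝ≥0∞) * powENat q m ≤ C := by
  obtain ⟨K, hK⟩ := exists_mul_powENat_le hq one_pos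
  refine ⟨K + 1, fun m => ?_⟩
  rcases le_total (K : ℕ∞) m with h | h
  · exact (hK m h).trans (by simp)
  · calc (m : ℝ≥0∞) * powENat q m ≤ (K : ℝ≥0∞) * 1 := by
          gcongr
          · exact_mod_cast ENat.toENNReal_mono h
          · exact powENat_le_one hq.le m
      _ ≤ _ := by simp

variable {S L : Type*} [MeasurableSpace S] [MeasurableSpace L] {D : LifeSpace S L}
  {P : Kernel S L} [IsMarkovKernel P]

theorem extProb_le_one (s : S) : extProb D P s ≤ 1 := prob_le_one

theorem extWeight_eq_genWeight (n : ℕ) : extWeight D P n = genWeight D n (extProb D P) := rfl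

theorem extWeight_le (n : ℕ) (ω : Population S L) :
    extWeight D P n ω ≤ powENat (⨆ r, extProb D P r) (D.genSize n ω) := by
  rw [extWeight_eq_genWeight, ← genWeight_const D n (iSup_le extProb_le_one)]
  exact genWeight_mono D n (fun r => le_iSup (extProb D P) r) ω

theorem le_extWeight (s : S) (n : ℕ) (ω : Population S L) :
    powENat (⨅ r, extProb D P r) (D.genSize n ω) ≤ extWeight D P n ω := by
  rw [extWeight_eq_genWeight,
    ← genWeight_const D n ((iInf_le (extProb D P) s).trans (extProb_le_one s))]
  exact genWeight_mono D n (fun r => iInf_le (extProb D P) r) ω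

/-- An infinite generation has weight at most `q ^ ∞ = 0`, so almost surely not all its progenies
die out. When they do die out the generation is thus finite, and extinction passes back from
generation `n` to the ancestor. -/
theorem ae_mem_extinction_of_mem_subPopsIn (hq : ⨆ r, extProb D P r < 1) (s : S) :
    ∀ᵐ ω ∂popLaw D P s, ∀ n, ω ∈ D.subPopsIn n D.extinction → ω ∈ D.extinction := by
  have h : ∀ᵐ ω ∂popLaw D P s, ∀ n, ω ∈ D.subPopsIn n D.extinction → D.genSize n ω ≠ ⊤ := by
    refine ae_all_iff.2 fun n => ?_
    let B : Set (Population S L) := {ω | D.genSize n ω = ⊤}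
    have hB : MeasurableSet B := measurable_genSize D n (measurableSet_singleton _)
    have hE := measurableSet_extinction (S := S) (L := L) D
    have hBdep : DependsOnLives (B.indicator (1 : Population S L → ℝ≥0∞))
        {y | y.length < n} := by
      classical
      intro s w w' h
      have := DependsOnLives.genSize (D := D) n (s := s) h
      simp only [Set.indicator_apply, B, Set.mem_ofPred_eq, this, Pi.one_apply]
    have key := lintegral_mul_indicator_subPopsIn (D := D) (P := P) s n hE
      (measurable_one.indicator hB) hBdep
    have h0 : ∀ ω, B.indicator (1 : Population S L → ℝ≥0∞) ω
        * genWeight D n (fun r => popLaw D P r D.extinction) ω = 0 := by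
      intro ω
      by_cases hω : ω ∈ B
      · have h1 := extWeight_le (D := D) (P := P) n ω
        rw [show D.genSize n ω = ⊤ from hω, powENat_top hq] at h1
        rw [show genWeight D n (fun r => popLaw D P r D.extinction) ω = 0 from
          le_antisymm h1 zero_le, mul_zero]
      · rw [Set.indicator_of_notMem hω, zero_mul]
    simp_rw [h0, lintegral_zero] at key
    rw [lintegral_eq_zero_iff (f := fun ω => B.indicator (1 : Population S L → ℝ≥0∞) ω
        * (D.subPopsIn n D.extinction).indicator 1 ω) ((measurable_one.indicator hB).mul
      (measurable_one.indicator (measurableSet_subPopsIn n hE)))] at key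
    filter_upwards [key] with ω hω h1 h2
    have h2 : ω ∈ B := h2
    simp [Set.indicator_of_mem h1, Set.indicator_of_mem h2] at hω
  filter_upwards [h] with ω hω n
  induction n with
  | zero => rw [subPopsIn_zero]; exact id
  | succ n ih => exact fun h => ih (mem_subPopsIn_of_succ h (hω _ h))

/-- Integrating over extinction is the same as weighting with the conditional probability of
extinction given the first `n` generations. -/
theorem lintegral_mul_indicator_extinction (hq : ⨆ r, extProb D P r < 1) (s : S) (n : ℕ)
    {g : Population S L → ℝ≥0∞} (hg : Measurable g) (hdep : DependsOnLives g {y | y.length < n}) :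
    ∫⁻ ω, g ω * D.extinction.indicator 1 ω ∂popLaw D P s
      = ∫⁻ ω, g ω * extWeight D P n ω ∂popLaw D P s := by
  rw [extWeight_eq_genWeight]
  refine Eq.trans (lintegral_congr_ae ?_)
    (lintegral_mul_indicator_subPopsIn s n (measurableSet_extinction D) hg hdep)
  filter_upwards [ae_mem_extinction_of_mem_subPopsIn hq s] with ω hω
  by_cases h : ω ∈ D.extinction
  · rw [Set.indicator_of_mem h, Set.indicator_of_mem (extinction_subset_subPopsIn n h)]
  · rw [Set.indicator_of_notMem h, Set.indicator_of_notMem (mt (hω n) h)]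

theorem lintegral_condLaw (s : S) (g : Population S L → ℝ≥0∞) :
    ∫⁻ ω, g ω ∂condLaw D P s
      = (∫⁻ ω, g ω * D.extinction.indicator 1 ω ∂popLaw D P s) / extProb D P s := by
  rw [condLaw, ProbabilityTheory.cond, lintegral_smul_measure, ENNReal.div_eq_inv_mul,
    ← lintegral_indicator (measurableSet_extinction D)]
  congr with ω
  by_cases h : ω ∈ D.extinction <;> simp [h]

theorem DependsOnLives.comp_genSize (n : ℕ) (f : ℕ∞ → ℝ≥0∞) :
    DependsOnLives (fun ω => f (D.genSize n ω)) {y | y.length < n} :=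
  (DependsOnLives.genSize n).comp f

theorem measurable_comp_genSize (n : ℕ) (f : ℕ∞ → ℝ≥0∞) :
    Measurable fun ω => f (D.genSize n ω) :=
  (Measurable.of_discrete (f := f)).comp (measurable_genSize D n)

theorem lintegral_genSize_condLaw (hq : ⨆ r, extProb D P r < 1) (s : S) (n : ℕ) :
    ∫⁻ ω, (D.genSize n ω : ℝ≥0∞) ∂condLaw D P s
      = (∫⁻ ω, (D.genSize n ω : ℝ≥0∞) * extWeight D P n ω ∂popLaw D P s) / extProb D P s := by
  rw [lintegral_condLaw, lintegral_mul_indicator_extinction hq s n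
    (measurable_comp_genSize n _) (DependsOnLives.comp_genSize n _)]

/-- Split `X_n` at `K`. The small part `f` is bounded by `K` and eventually `0` on extinction, so
dominated convergence applies. For the large part `g`, extinction is replaced by its conditional
probability, at most `q ^ X_n`, and `m q ^ m ≤ ε / 2` for `m ≥ K`. -/
theorem isSubcritical_condLaw (hq : ⨆ r, extProb D P r < 1) {s : S} (hs : 0 < extProb D P s) :
    IsSubcritical D (condLaw D P s) := by
  have hE := measurableSet_extinction (S := S) (L := L) D
  suffices h : Tendsto (fun n => ∫⁻ ω, (D.genSize n ω : ℝ≥0∞) *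
      D.extinction.indicator 1 ω ∂popLaw D P s) atTop (𝓝 0) by
    have := ENNReal.Tendsto.div_const h (b := extProb D P s) (Or.inr hs.ne')
    rw [ENNReal.zero_div] at this
    simpa only [IsSubcritical, lintegral_condLaw] using this
  refine ENNReal.tendsto_nhds_zero.2 fun ε hε => ?_
  obtain ⟨K, hK⟩ := exists_mul_powENat_le hq (ENNReal.half_pos hε.ne')
  let f : ℕ∞ → ℝ≥0∞ := fun m => if (K : ℕ∞) ≤ m then 0 else m
  let g : ℕ∞ → ℝ≥0∞ := fun m => if (K : ℕ∞) ≤ m then m else 0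
  have hfg : ∀ m : ℕ∞, (m : ℝ≥0∞) = f m + g m := fun m => by
    by_cases h : (K : ℕ∞) ≤ m <;> simp [f, g, h]
  have hf : Tendsto (fun n => ∫⁻ ω, f (D.genSize n ω) * D.extinction.indicator 1 ω
      ∂popLaw D P s) atTop (𝓝 0) := by
    have := tendsto_lintegral_of_dominated_convergence (μ := popLaw D P s)
      (F := fun n ω => f (D.genSize n ω) * D.extinction.indicator 1 ω) (f := fun _ => 0)
      (fun _ => (K : ℝ≥0∞))
      (fun n => (measurable_comp_genSize n f).mul (measurable_one.indicator hE))
      (fun n => ae_of_all _ fun ω => ?_) (by simp) (ae_of_all _ fun ω => ?_)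
    · simpa using this
    · refine (mul_le_mul' ?_ (Set.indicator_le_self' (by simp) ω)).trans (mul_one _).le
      by_cases h : (K : ℕ∞) ≤ D.genSize n ω
      · simp [f, h]
      · simpa [f, h] using ENat.toENNReal_mono (not_le.1 h).le
    · by_cases hω : ω ∈ D.extinction
      · refine tendsto_const_nhds.congr' ?_
        filter_upwards [eventually_genSize_eq_zero hω] with n hn
        simp [f, hn]
      · simp [hω]
  have hg : ∀ n, ∫⁻ ω, g (D.genSize n ω) * D.extinction.indicator 1 ω ∂popLaw D P s ≤ ε / 2 := by
    intro n
    rw [lintegral_mul_indicator_extinction hq s n (measurable_comp_genSize n g)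
      (DependsOnLives.comp_genSize n g)]
    refine (lintegral_mono (g := fun _ => ε / 2) fun ω => ?_).trans (by simp)
    by_cases h : (K : ℕ∞) ≤ D.genSize n ω
    · simp only [g, h, if_true]
      exact (mul_le_mul_right (extWeight_le n ω) _).trans (hK _ h)
    · simp [g, h]
  filter_upwards [ENNReal.tendsto_nhds_zero.1 hf _ (ENNReal.half_pos hε.ne')] with n hn
  simp_rw [hfg, add_mul]
  rw [lintegral_add_left (f := fun ω => f (D.genSize n ω) * D.extinction.indicator 1 ω)
    ((measurable_comp_genSize n f).mul (measurable_one.indicator hE)), ← ENNReal.add_halves ε]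
  exact add_le_add hn (hg n)

theorem tendsto_lintegral_genSize_mul_powENat {q : ℝ≥0∞} (hq : q < 1) (s : S)
    (h : ∀ᵐ ω ∂popLaw D P s, Tendsto (fun n => (D.genSize n ω : ℝ≥0∞)) atTop (𝓝 0) ∨
      Tendsto (fun n => (D.genSize n ω : ℝ≥0∞)) atTop (𝓝 ∞)) :
    Tendsto (fun n => ∫⁻ ω, (D.genSize n ω : ℝ≥0∞) * powENat q (D.genSize n ω) ∂popLaw D P s)
      atTop (𝓝 0) := by
  obtain ⟨C, hC⟩ := exists_mul_powENat_le_nat hq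
  have := tendsto_lintegral_of_dominated_convergence (μ := popLaw D P s)
    (F := fun n ω => (D.genSize n ω : ℝ≥0∞) * powENat q (D.genSize n ω)) (f := fun _ => 0)
    (fun _ => (C : ℝ≥0∞)) (fun n => measurable_comp_genSize n fun m => m * powENat q m)
    (fun n => ae_of_all _ fun ω => hC _) (by simp) ?_
  · simpa using this
  filter_upwards [h] with ω hω
  rcases hω with hω | hω
  · refine tendsto_of_tendsto_of_tendsto_of_le_of_le tendsto_const_nhds hω
      (fun n => zero_le (a := _)) fun n => ?_
    exact (mul_le_mul_right (powENat_le_one hq.le _) _).trans (mul_one _).le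
  · refine ENNReal.tendsto_nhds_zero.2 fun ε hε => ?_
    obtain ⟨K, hK⟩ := exists_mul_powENat_le hq hε
    filter_upwards [ENNReal.tendsto_nhds_top_iff_nat.1 hω K] with n hn
    exact hK _ (by exact_mod_cast hn.le)

/-- Let `B m` be the event that some generation from `m` on has size in `{1, ..., K}`. At the first
such generation the conditional extinction probability is at least `p ^ K`, so `p ^ K ℙ(B m) ≤ ℙ(B m
∩ E)`, and the right side tends to `0`. Hence almost surely the sizes visit `{1, ..., K}` finitely
often, for every `K`. -/
theorem ae_tendsto_zero_or_top (hq : ⨆ r, extProb D P r < 1) (hp : 0 < ⨅ r, extProb D P r)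
    (s : S) :
    ∀ᵐ ω ∂popLaw D P s, Tendsto (fun n => (D.genSize n ω : ℝ≥0∞)) atTop (𝓝 0) ∨
      Tendsto (fun n => (D.genSize n ω : ℝ≥0∞)) atTop (𝓝 ∞) := by
  set p := ⨅ r, extProb D P r with hp_def
  have hp1 : p ≤ 1 := (iInf_le _ s).trans (extProb_le_one s)
  have hE := measurableSet_extinction (S := S) (L := L) D
  have key : ∀ K : ℕ, ∀ᵐ ω ∂popLaw D P s,
      ¬ ∃ᶠ n in atTop, D.genSize n ω ≠ 0 ∧ D.genSize n ω ≤ K := by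
    intro K
    let C : ℕ → Set (Population S L) := fun n => {ω | D.genSize n ω ≠ 0 ∧ D.genSize n ω ≤ K}
    have hC : ∀ n, MeasurableSet (C n) := fun n =>
      measurable_genSize D n (MeasurableSet.of_discrete (s := {m : ℕ∞ | m ≠ 0 ∧ m ≤ K}))
    let B : ℕ → Set (Population S L) := fun m => ⋃ j, C (m + j)
    have hB : ∀ m, MeasurableSet (B m) := fun m => .iUnion fun j => hC _
    have hle : ∀ m, p ^ K * popLaw D P s (B m) ≤ popLaw D P s (B m ∩ D.extinction) := by
      intro m
      -- `T j` says that the first visit from generation `m` on occurs at `m + j`; this is decided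
      -- by the lives before that generation.
      let T := disjointed fun j => C (m + j)
      have hT : ∀ j, MeasurableSet (T j) := fun j => MeasurableSet.disjointed (fun j => hC _) j
      have hTdisj : Pairwise (Function.onFun Disjoint T) := disjoint_disjointed _
      have hTB : B m = ⋃ j, T j := (iUnion_disjointed (f := fun j => C (m + j))).symm
      have hTdep : ∀ j, DependsOnLives ((T j).indicator (1 : Population S L → ℝ≥0∞))
          {y | y.length < m + j} := by
        classical
        intro j s w w' h
        have h1 : ∀ i ≤ j, ((s, w) ∈ C (m + i) ↔ (s, w') ∈ C (m + i)) := fun i hi => by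
          have := DependsOnLives.genSize (D := D) (m + i) (s := s) (w := w) (w' := w') fun y hy =>
            h y (show y.length < m + j from lt_of_lt_of_le hy (by omega))
          simp only [C, Set.mem_ofPred_eq, this]
        have : (s, w) ∈ T j ↔ (s, w') ∈ T j := by
          simp only [T, disjointed_apply, Set.mem_sdiff, Finset.sup_set_eq_biUnion, Set.mem_iUnion,
            Finset.mem_Iio, exists_prop, h1 j le_rfl]
          refine and_congr_right fun _ => not_congr (exists_congr fun i => ?_)
          exact and_congr_right fun hi => h1 i hi.le
        simp only [Set.indicator_apply, this, Pi.one_apply]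
      have hTle : ∀ j, p ^ K * popLaw D P s (T j) ≤ popLaw D P s (T j ∩ D.extinction) := by
        intro j
        have h1 := lintegral_mul_indicator_extinction hq s (m + j)
          (measurable_one.indicator (hT j)) (hTdep j)
        have h2 : ∀ ω, (T j).indicator (1 : Population S L → ℝ≥0∞) ω *
            D.extinction.indicator 1 ω = (T j ∩ D.extinction).indicator 1 ω := fun ω => by
          rw [Set.inter_indicator_one]; rfl
        simp_rw [h2] at h1
        rw [lintegral_indicator_one ((hT j).inter hE)] at h1
        rw [h1, ← lintegral_indicator_one (hT j),
          ← lintegral_const_mul _ (measurable_one.indicator (hT j))]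
        refine lintegral_mono fun ω => ?_
        by_cases hω : ω ∈ T j
        · have h3 : ω ∈ C (m + j) := disjointed_subset _ j hω
          simp only [Set.indicator_of_mem hω, Pi.one_apply, mul_one, one_mul]
          exact (powENat_antitone hp1 h3.2).trans (le_extWeight s (m + j) ω)
        · simp [hω]
      rw [hTB, Set.iUnion_inter, measure_iUnion hTdisj hT,
        measure_iUnion (fun i j hij => (hTdisj hij).mono Set.inter_subset_left
          Set.inter_subset_left) fun j => (hT j).inter hE, ← ENNReal.tsum_mul_left]
      exact ENNReal.tsum_le_tsum hTle
    have hlim : Tendsto (fun m => popLaw D P s (B m ∩ D.extinction)) atTop (𝓝 0) := by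
      have hanti : Antitone fun m => B m ∩ D.extinction := by
        refine fun m m' h => Set.inter_subset_inter_left _ ?_
        refine Set.iUnion_subset fun j => ?_
        have : m' + j = m + (m' - m + j) := by omega
        rw [this]
        exact Set.subset_iUnion (fun j => C (m + j)) _
      have := tendsto_measure_iInter_atTop (μ := popLaw D P s)
        (fun m => ((hB m).inter hE).nullMeasurableSet) hanti ⟨0, measure_ne_top _ _⟩
      -- On extinction all late generations are empty.
      have h0 : ⋂ m, B m ∩ D.extinction = ∅ := by
        refine Set.eq_empty_of_forall_notMem fun ω hω => ?_
        rw [Set.mem_iInter] at hω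
        obtain ⟨n, hn⟩ := exists_genSize_eq_zero (hω 0).2
        obtain ⟨j, hj⟩ := Set.mem_iUnion.1 (hω n).1
        exact hj.1 (genSize_eq_zero_of_le (Nat.le_add_right n j) hn)
      rw [h0, measure_empty] at this
      exact this
    have hpK : p ^ K ≠ 0 := pow_ne_zero _ hp.ne'
    have hzero : popLaw D P s (⋂ m, B m) = 0 := by
      have h1 : ∀ m, p ^ K * popLaw D P s (⋂ m, B m) ≤ popLaw D P s (B m ∩ D.extinction) :=
        fun m => (mul_le_mul_right (measure_mono (Set.iInter_subset _ m)) _).trans (hle m)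
      have h2 := le_antisymm (ge_of_tendsto' hlim h1) zero_le
      exact (mul_eq_zero.1 h2).resolve_left hpK
    refine measure_mono_null (fun ω hω => ?_) hzero
    have hω := not_not.1 hω
    refine Set.mem_iInter.2 fun m => ?_
    obtain ⟨n, hn, h⟩ := frequently_atTop.1 hω m
    exact Set.mem_iUnion.2 ⟨n - m, by rw [Nat.add_sub_cancel' hn]; exact h⟩
  filter_upwards [ae_all_iff.2 key] with ω hω
  by_cases h0 : ∃ n, D.genSize n ω = 0
  · obtain ⟨n, hn⟩ := h0
    refine Or.inl (tendsto_const_nhds.congr' ?_)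
    filter_upwards [eventually_ge_atTop n] with m hm
    simp [genSize_eq_zero_of_le hm hn]
  · simp only [not_exists] at h0
    refine Or.inr (ENNReal.tendsto_nhds_top fun K => ?_)
    filter_upwards [not_frequently.1 (hω K)] with n hn
    have : (K : ℕ∞) < D.genSize n ω := not_le.1 fun h => hn ⟨h0 n, h⟩
    exact_mod_cast ENat.toENNReal_lt.2 this

end Branching
end

/-! ### The generating function and the single-type case. -/

noncomputable section

namespace Branching

open Encodable

theorem powENat_mono {a b : ℝ≥0∞} (hab : a ≤ b) (hb : b ≤ 1) (m : ℕ∞) :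
    powENat a m ≤ powENat b m := by
  rw [powENat_eq_expNeg (hab.trans hb), powENat_eq_expNeg hb]
  exact antitone_expNeg (mul_le_mul_left (antitone_negLog hab) _)

/-- By convexity, the tangent to the `k`-th power at `t` lies below the curve at `1`. The form with
`u = 1 - t` avoids subtraction, and for `k = 0` the truncated exponent is multiplied by `0`. -/
theorem pow_add_mul_le_one {t u : ℝ≥0∞} (h : t + u = 1) (k : ℕ) :
    t ^ k + u * (k * t ^ (k - 1)) ≤ 1 := by
  induction k with
  | zero => simp
  | succ k ih =>
    have ht : t ≤ 1 := h ▸ le_self_add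
    have e : t ^ (k + 1) + u * ((k + 1 : ℕ) * t ^ (k + 1 - 1))
        = t * (t ^ k + u * (k * t ^ (k - 1))) + u * t ^ k := by
      cases k with
      | zero => simp
      | succ j =>
        simp only [Nat.add_sub_cancel]
        push_cast
        ring
    rw [e, ← h]
    gcongr
    · exact (mul_le_mul_right ih t).trans (mul_one t).le
    · exact (mul_le_mul_right (pow_le_one' ht k) u).trans (mul_one u).le

theorem pow_add_mul_lt_one {t u : ℝ≥0∞} (h : t + u = 1) (ht : t < 1) {k : ℕ} (hk : 2 ≤ k) :
    t ^ k + u * (k * t ^ (k - 1)) < 1 := by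
  obtain ⟨j, rfl⟩ : ∃ j, k = j + 2 := ⟨k - 2, by omega⟩
  have hu : u ≠ 0 := by rintro rfl; exact ht.ne (by simpa using h)
  have hu1 : u ≤ 1 := h ▸ le_add_self
  have e : t ^ (j + 2) + u * ((j + 2 : ℕ) * t ^ (j + 2 - 1))
      = t * (t ^ (j + 1) + u * ((j + 1 : ℕ) * t ^ j)) + u * t ^ (j + 1) := by
    rw [show j + 2 - 1 = j + 1 from rfl]
    push_cast
    ring
  have h1 := pow_add_mul_le_one h (j + 1)
  rw [Nat.add_sub_cancel] at h1
  rw [e]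
  calc t * (t ^ (j + 1) + u * ((j + 1 : ℕ) * t ^ j)) + u * t ^ (j + 1)
      ≤ t * 1 + u * t ^ (j + 1) := by gcongr
    _ < t * 1 + u * 1 := by
        refine ENNReal.add_lt_add_left (by rw [mul_one]; exact ht.ne_top) ?_
        refine ENNReal.mul_lt_mul_right hu (ne_top_of_le_ne_top ENNReal.one_ne_top hu1) ?_
        exact pow_lt_one' ht (Nat.succ_ne_zero j)
    _ = 1 := by rw [mul_one, mul_one, h]

theorem powENat_add_mul_le_one {t u : ℝ≥0∞} (h : t + u = 1) (ht : t < 1) (m : ℕ∞) :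
    powENat t m + u * (m * powENat t (m - 1)) ≤ 1 := by
  cases m with
  | top => simp [powENat_top ht, show (⊤ : ℕ∞) - 1 = ⊤ from rfl]
  | coe k => exact pow_add_mul_le_one h k

theorem powENat_add_mul_lt_one {t u : ℝ≥0∞} (h : t + u = 1) (ht : t < 1) {m : ℕ∞} (hm : 2 ≤ m) :
    powENat t m + u * (m * powENat t (m - 1)) < 1 := by
  cases m with
  | top => simp [powENat_top ht, show (⊤ : ℕ∞) - 1 = ⊤ from rfl]
  | coe k => exact pow_add_mul_lt_one h ht (by exact_mod_cast hm)

theorem powENat_zero_left {m : ℕ∞} (hm : m ≠ 0) : powENat 0 m = 0 := by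
  cases m with
  | top => exact powENat_top zero_lt_one
  | coe k => exact zero_pow (by exact_mod_cast hm)

theorem mul_powENat_div {q : ℝ≥0∞} (hq0 : 0 < q) (hq : q < 1) (m : ℕ∞) :
    (m : ℝ≥0∞) * powENat q m / q = m * powENat q (m - 1) := by
  cases m with
  | top => simp [powENat_top hq, show (⊤ : ℕ∞) - 1 = ⊤ from rfl]
  | coe k =>
    cases k with
    | zero => simp
    | succ k =>
      rw [mul_div_assoc]
      congr 1
      change q ^ (k + 1) / q = q ^ k
      rw [pow_succ, ENNReal.mul_div_cancel_right hq0.ne' hq.ne_top]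

theorem hasDerivAt_tsum_mul_pow {p : ℕ → ℝ} (hp : ∀ k, |p k| ≤ 1) {x : ℝ} (hx : |x| < 1) :
    HasDerivAt (fun t => ∑' k, p k * t ^ k) (∑' k, p k * (k * x ^ (k - 1))) x := by
  -- On the ball of radius `r` the differentiated series is dominated by `∑ k r ^ (k - 1)`.
  obtain ⟨r, hxr, hr⟩ := exists_between hx
  have hr0 : 0 ≤ r := (abs_nonneg x).trans hxr.le
  have hu : Summable fun k : ℕ => (k : ℝ) * r ^ (k - 1) := by
    rw [← summable_nat_add_iff 1]
    have h1 := summable_pow_mul_geometric_of_norm_lt_one (R := ℝ) 1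
      (r := r) (by rwa [Real.norm_of_nonneg hr0])
    have h2 := summable_geometric_of_lt_one hr0 hr
    refine (h1.add h2).congr fun k => ?_
    rw [Nat.add_sub_cancel]
    push_cast
    ring
  refine hasDerivAt_tsum_of_isPreconnected (t := Metric.ball 0 r) (y₀ := 0) hu Metric.isOpen_ball
    (convex_ball _ _).isPreconnected (g := fun k t => p k * t ^ k)
    (g' := fun k t => p k * (k * t ^ (k - 1)))
    (fun k y _ => (hasDerivAt_pow k y).const_mul (p k)) (fun k y hy => ?_) ?_ ?_ ?_
  · have hy : |y| ≤ r := by simpa using (Metric.mem_ball.1 hy).le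
    rw [Real.norm_eq_abs, abs_mul, abs_mul, abs_pow, Nat.abs_cast]
    calc |p k| * (k * |y| ^ (k - 1)) ≤ 1 * (k * r ^ (k - 1)) := by
          gcongr
          exact hp k
      _ = _ := one_mul _
  · exact Metric.mem_ball_self ((abs_nonneg x).trans_lt hxr)
  · exact summable_of_ne_finset_zero (s := {0}) fun k hk => by
      simp [show k ≠ 0 by simpa using hk]
  · simpa using hxr

variable {S L : Type*} [MeasurableSpace S] [MeasurableSpace L] {D : LifeSpace S L}

variable (D) in
theorem measurable_offspring : Measurable D.offspring := by
  have h : Measurable fun l => (D.offspring l : ℝ≥0∞) := by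
    have : ∀ l, (D.offspring l : ℝ≥0∞) = ∑' k, {l | D.τ k l < ∞}.indicator 1 l := fun l => by
      rw [LifeSpace.offspring, ← ENNReal.tsum_set_one,
        tsum_subtype {k | D.τ k l < ∞} fun _ => (1 : ℝ≥0∞)]
      rfl
    simp_rw [this]
    exact Measurable.tsum fun k => measurable_one.indicator
      (measurableSet_lt (D.measurable_τ k) measurable_const)
  refine measurable_to_countable' fun k => ?_
  have : D.offspring ⁻¹' {k} = (fun l => (D.offspring l : ℝ≥0∞)) ⁻¹' {(k : ℝ≥0∞)} := by
    ext l; simp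
  rw [this]
  exact h (measurableSet_singleton _)

theorem genSize_one (ω : Population S L) : D.genSize 1 ω = D.offspring (ω.2 []) := by
  have : D.generation 1 ω = (fun k => [k]) '' {k | D.τ k (ω.2 []) < ∞} := by
    ext x
    constructor
    · rintro ⟨hx, hr⟩
      obtain ⟨k, rfl⟩ := List.length_eq_one_iff.1 hx
      exact ⟨k, by simpa [LifeSpace.realised, LifeSpace.birthTime] using hr, rfl⟩
    · rintro ⟨k, hk, rfl⟩
      exact ⟨rfl, by simpa [LifeSpace.realised, LifeSpace.birthTime] using hk⟩
  rw [genSize_eq_encard, this, LifeSpace.offspring]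
  exact Function.Injective.encard_image (fun _ _ h => by simpa using h) _

theorem genSize_zero (ω : Population S L) : D.genSize 0 ω = 1 := by
  have : D.generation 0 ω = {[]} := by
    ext x
    constructor
    · rintro ⟨hx, -⟩
      exact List.eq_nil_of_length_eq_zero hx
    · rintro rfl
      exact ⟨rfl, by simp [LifeSpace.realised, LifeSpace.birthTime]⟩
  rw [genSize_eq_encard, this, Set.encard_singleton]

/-- The last entry of an address is the rank of the ancestor's child from whom the individual stems.
-/
theorem subPopsIn_one_genSize_eq_zero (n : ℕ) :
    D.subPopsIn 1 {ω : Population S L | D.genSize n ω = 0} = {ω | D.genSize (n + 1) ω = 0} := by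
  ext ω
  simp only [LifeSpace.subPopsIn, Set.mem_ofPred_eq, genSize_eq_encard, Set.encard_eq_zero]
  constructor
  · intro h
    refine Set.eq_empty_of_forall_notMem fun x hx => ?_
    obtain ⟨hxn, hxr⟩ := hx
    rcases List.eq_nil_or_concat x with rfl | ⟨u, k, rfl⟩
    · simp at hxn
    · rw [List.concat_eq_append] at hxn hxr
      have h1 := append_mem_realised.1 hxr
      have h2 : u ∈ D.generation n (D.subPop [k] ω) := ⟨by simpa using hxn, h1.2⟩
      rw [h [k] ⟨rfl, h1.1⟩] at h2
      exact h2
  · rintro h x ⟨hx, hxr⟩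
    refine Set.eq_empty_of_forall_notMem fun u hu => ?_
    have : u ++ x ∈ D.generation (n + 1) ω := by
      refine ⟨?_, append_mem_realised.2 ⟨hxr, hu.2⟩⟩
      have h1 : x.length = 1 := hx
      have h2 : u.length = n := hu.1
      simp [h1, h2]
    rw [h] at this
    exact this

theorem lintegral_offspring_eq_tsum (P : Kernel S L) (s : S) {f : ℕ∞ → ℝ≥0∞} (hf : f ⊤ = 0) :
    ∫⁻ l, f (D.offspring l) ∂P s = ∑' k : ℕ, P s {l | D.offspring l = k} * f k := by
  have hsum : ∀ l, f (D.offspring l)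
      = ∑' k : ℕ, {l | D.offspring l = k}.indicator (fun _ => f k) l := by
    intro l
    cases h : D.offspring l with
    | top => simp [hf, Set.indicator, h]
    | coe k =>
      rw [tsum_eq_single k fun j hj => Set.indicator_of_notMem (by simp [h, hj.symm]) _]
      simp [Set.indicator, h]
  simp_rw [hsum]
  have hm : ∀ k : ℕ, MeasurableSet {l | D.offspring l = k} := fun k =>
    measurable_offspring D (measurableSet_singleton _)
  rw [lintegral_tsum fun k => (measurable_const.indicator (hm k)).aemeasurable]
  congr with k
  rw [lintegral_indicator_const (hm k), mul_comm]

variable {P : Kernel S L} [IsMarkovKernel P]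

theorem lintegral_comp_life_nil (s : S) {g : L → ℝ≥0∞} (hg : Measurable g) :
    ∫⁻ ω, g (ω.2 []) ∂popLaw D P s = ∫⁻ l, g l ∂P s := by
  have hG : Measurable fun ω : Population S L => g (ω.2 []) := by fun_prop
  rw [lintegral_eq_resample s [] hG, lintegral_popLaw_fst s (measurable_resample [] hG)]
  · simp [resample, LifeSpace.type]
  · intro s w w' h
    simp [h [] fun _ => rfl]

theorem measurable_comp_offspring (f : ℕ∞ → ℝ≥0∞) : Measurable fun l => f (D.offspring l) :=
  (Measurable.of_discrete (f := f)).comp (measurable_offspring D)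

theorem lintegral_comp_offspring (s : S) (f : ℕ∞ → ℝ≥0∞) :
    ∫⁻ ω, f (D.offspring (ω.2 [])) ∂popLaw D P s = ∫⁻ l, f (D.offspring l) ∂P s :=
  lintegral_comp_life_nil s (measurable_comp_offspring f)

theorem hasDerivAt_offspringGF {s : S} (hq : extProb D P s < 1) :
    HasDerivAt (offspringGF D P s) (∫⁻ l, (D.offspring l : ℝ≥0∞) *
      powENat (extProb D P s) (D.offspring l - 1) ∂P s).toReal (extProb D P s).toReal := by
  set q := extProb D P s
  have hq' : |q.toReal| < 1 := by
    rw [abs_of_nonneg ENNReal.toReal_nonneg]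
    simpa using (ENNReal.toReal_lt_toReal hq.ne_top ENNReal.one_ne_top).2 hq
  have h := hasDerivAt_tsum_mul_pow (p := fun k => (P s).real {l | D.offspring l = k})
    (fun k => by rw [abs_of_nonneg measureReal_nonneg]; exact measureReal_le_one) hq'
  refine h.congr_deriv ?_
  rw [lintegral_offspring_eq_tsum (D := D) P s (f := fun m => m * powENat q (m - 1)) (by
    simp [powENat_top hq, show (⊤ : ℕ∞) - 1 = ⊤ from rfl]), ENNReal.tsum_toReal_eq]
  · congr with k
    change _ = (P s {l | D.offspring l = k} * ((k : ℝ≥0∞) * q ^ (k - 1))).toReal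
    simp [Measure.real]
  · intro k
    change P s {l | D.offspring l = k} * ((k : ℝ≥0∞) * q ^ (k - 1)) ≠ ∞
    exact ENNReal.mul_ne_top (measure_ne_top _ _)
      (ENNReal.mul_ne_top (ENNReal.natCast_ne_top k) (ENNReal.pow_ne_top hq.ne_top))

section SingleType

variable [Subsingleton S]

theorem genWeight_of_subsingleton (n : ℕ) (q : S → ℝ≥0∞) (hq : ∀ r, q r ≤ 1) (s : S)
    (ω : Population S L) : genWeight D n q ω = powENat (q s) (D.genSize n ω) := by
  rw [← genWeight_const D n (hq s), show q = fun _ => q s from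
    funext fun r => congrArg q (Subsingleton.elim r s)]

theorem iSup_extProb_of_subsingleton (s : S) : ⨆ r, extProb D P r = extProb D P s := by
  have : Nonempty S := ⟨s⟩
  rw [show extProb D P = fun _ => extProb D P s from
    funext fun r => congrArg _ (Subsingleton.elim r s), ciSup_const]

/-- The branching property at generation one: `ℙ(X_n = 0)` is the `n`-th iterate of `f` at `0`. -/
theorem measure_genSize_succ_eq_zero (s : S) (n : ℕ) :
    popLaw D P s {ω | D.genSize (n + 1) ω = 0}
      = ∫⁻ l, powENat (popLaw D P s {ω | D.genSize n ω = 0}) (D.offspring l) ∂P s := by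
  have hF : ∀ n, MeasurableSet {ω : Population S L | D.genSize n ω = 0} := fun n =>
    measurable_genSize D n (measurableSet_singleton _)
  have := lintegral_mul_indicator_subPopsIn (D := D) (P := P) s 1 (hF n) (g := fun _ => 1)
    measurable_const fun _ _ _ _ => rfl
  simp only [one_mul, subPopsIn_one_genSize_eq_zero] at this
  rw [lintegral_indicator_one (hF (n + 1))] at this
  rw [this]
  simp_rw [genWeight_of_subsingleton 1 _ (fun r => prob_le_one) s, genSize_one]
  exact lintegral_comp_offspring s _

/-- The extinction probability is below every fixed point of the generating function. -/
theorem extProb_le_of_lintegral_powENat_le {s : S} {t : ℝ≥0∞} (ht : t ≤ 1)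
    (h : ∫⁻ l, powENat t (D.offspring l) ∂P s ≤ t) : extProb D P s ≤ t := by
  -- Since `f` is increasing and `f(t) ≤ t`, its iterates from `0` never exceed `t`.
  have ha : ∀ n, popLaw D P s {ω | D.genSize n ω = 0} ≤ t := by
    intro n
    induction n with
    | zero => simp [genSize_zero]
    | succ n ih =>
      rw [measure_genSize_succ_eq_zero]
      exact (lintegral_mono fun l => powENat_mono ih ht _).trans h
  have hmono : Monotone fun n => {ω : Population S L | D.genSize n ω = 0} :=
    fun n m hnm ω hω => genSize_eq_zero_of_le hnm hω
  have hsub : (D.extinction : Set (Population S L)) ⊆ ⋃ n, {ω | D.genSize n ω = 0} :=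
    fun ω hω => Set.mem_iUnion.2 (exists_genSize_eq_zero hω)
  refine (measure_mono hsub).trans ?_
  rw [hmono.measure_iUnion]
  exact iSup_le ha

/-- Truncation covers an infinite mean: choose `K` with `c = 𝔼[min(X, K)] > 1`, then `t < 1` with `t
^ K c > 1`. Integrating the tangent inequality at `min(X, K)` gives `f(t) + (1 - t) t ^ K c ≤ 1`.
Hence `f(t) ≤ t`, and `q ≤ t < 1`. -/
theorem extProb_lt_one_of_supercritical {s : S}
    (h : 1 < ∫⁻ l, (D.offspring l : ℝ≥0∞) ∂P s) : extProb D P s < 1 := by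
  have hsup : ∫⁻ l, (D.offspring l : ℝ≥0∞) ∂P s
      = ⨆ K : ℕ, ∫⁻ l, min (D.offspring l : ℝ≥0∞) K ∂P s := by
    rw [← lintegral_iSup]
    · refine lintegral_congr fun l => ?_
      rw [← inf_iSup_eq, ENNReal.iSup_natCast, inf_top_eq]
    · exact fun K => (measurable_comp_offspring fun m => (m : ℝ≥0∞)).min measurable_const
    · exact fun K K' hK l => min_le_min le_rfl (by exact_mod_cast hK)
  rw [hsup, lt_iSup_iff] at h
  obtain ⟨K, hK⟩ := h
  set c := ∫⁻ l, min (D.offspring l : ℝ≥0∞) K ∂P s with hc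
  have hcont : Tendsto (fun t : ℝ≥0∞ => t ^ K * c) (𝓝[<] 1) (𝓝 (1 ^ K * c)) := by
    refine ENNReal.Tendsto.mul_const (tendsto_nhdsWithin_of_tendsto_nhds ?_) (Or.inl (by simp))
    exact (ENNReal.continuous_pow K).tendsto 1
  rw [one_pow, one_mul] at hcont
  have : (𝓝[<] (1 : ℝ≥0∞)).NeBot := nhdsLT_neBot_of_exists_lt ⟨0, zero_lt_one⟩
  obtain ⟨t, ht, ht1⟩ := ((hcont.eventually (lt_mem_nhds hK)).and self_mem_nhdsWithin).exists
  have ht1 : t < 1 := ht1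
  refine (extProb_le_of_lintegral_powENat_le ht1.le ?_).trans_lt ht1
  have htu : t + (1 - t) = 1 := add_tsub_cancel_of_le ht1.le
  have hpt : ∀ m : ℕ∞, powENat t m + (1 - t) * t ^ K * min (m : ℝ≥0∞) K ≤ 1 := by
    intro m
    obtain ⟨k, hk⟩ : ∃ k : ℕ, min m (K : ℕ∞) = k :=
      ⟨(min m K).toNat, (ENat.natCast_toNat (ne_top_of_le_ne_top (ENat.natCast_ne_top K)
        (min_le_right _ _))).symm⟩
    have hkK : k ≤ K := by exact_mod_cast hk ▸ min_le_right m (K : ℕ∞)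
    have hkm : (k : ℕ∞) ≤ m := hk ▸ min_le_left _ _
    have hk' : min (m : ℝ≥0∞) K = k := by
      have := ENat.toENNReal_min m K
      rw [hk] at this
      simpa using this.symm
    rw [hk']
    calc _ ≤ t ^ k + (1 - t) * (k * t ^ (k - 1)) := by
          refine add_le_add (powENat_antitone ht1.le hkm) ?_
          rw [mul_assoc, mul_comm (t ^ K)]
          exact mul_le_mul' le_rfl (mul_le_mul' le_rfl
            (pow_le_pow_right_of_le_one' ht1.le (by omega)))
      _ ≤ 1 := pow_add_mul_le_one htu k
  have hint : ∫⁻ l, powENat t (D.offspring l) ∂P s + (1 - t) ≤ 1 := by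
    calc _ ≤ ∫⁻ l, powENat t (D.offspring l) ∂P s + (1 - t) * t ^ K * c := by
          gcongr
          rw [mul_assoc]
          exact le_mul_of_one_le_right' ht.le
      _ = ∫⁻ l, powENat t (D.offspring l)
            + (1 - t) * t ^ K * min (D.offspring l : ℝ≥0∞) K ∂P s := by
          rw [lintegral_add_left (measurable_comp_offspring _), lintegral_const_mul _
            ((measurable_comp_offspring fun m => (m : ℝ≥0∞)).min measurable_const)]
      _ ≤ ∫⁻ _, 1 ∂P s := lintegral_mono fun l => hpt _
      _ = 1 := by simp
  calc _ ≤ 1 - (1 - t) := ENNReal.le_sub_of_add_le_right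
          (ne_top_of_le_ne_top ENNReal.one_ne_top tsub_le_self) hint
    _ = t := ENNReal.sub_sub_cancel ENNReal.one_ne_top ht1.le

theorem lintegral_powENat_extProb {s : S} (hq : extProb D P s < 1) :
    ∫⁻ l, powENat (extProb D P s) (D.offspring l) ∂P s = extProb D P s := by
  have h := lintegral_mul_indicator_extinction (D := D) (P := P)
    (by rwa [iSup_extProb_of_subsingleton s]) s 1 (g := fun _ => 1) measurable_const
    fun _ _ _ _ => rfl
  simp only [one_mul, extWeight_eq_genWeight] at h
  rw [lintegral_indicator_one (measurableSet_extinction D)] at h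
  simp_rw [genWeight_of_subsingleton 1 _ extProb_le_one s, genSize_one] at h
  rw [lintegral_comp_offspring s] at h
  exact h.symm

/-- For `q < 1` this is the identity of (a) at `n = 1`, where the weight is `q ^ X`. For `q = 1`
extinction is almost sure and conditioning changes nothing. -/
theorem lintegral_offspring_condLaw {s : S} (hq0 : 0 < extProb D P s) :
    ∫⁻ ω, (D.offspring (ω.2 []) : ℝ≥0∞) ∂condLaw D P s
      = ∫⁻ l, (D.offspring l : ℝ≥0∞) * powENat (extProb D P s) (D.offspring l - 1) ∂P s := by
  rcases (extProb_le_one (D := D) (P := P) s).lt_or_eq with hq | hq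
  · have h := lintegral_genSize_condLaw (D := D) (P := P)
      (by rwa [iSup_extProb_of_subsingleton s]) s 1
    simp only [extWeight_eq_genWeight] at h
    simp_rw [genWeight_of_subsingleton 1 _ extProb_le_one s, genSize_one] at h
    rw [h, lintegral_comp_offspring s fun m => m * powENat (extProb D P s) m, div_eq_mul_inv,
      ← lintegral_mul_const _ (measurable_comp_offspring fun m => m * powENat (extProb D P s) m)]
    simp_rw [← div_eq_mul_inv, mul_powENat_div hq0 hq]
  · have hae : ∀ᵐ ω ∂popLaw D P s, ω ∈ D.extinction :=
      (mem_ae_iff_prob_eq_one (measurableSet_extinction D)).2 hq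
    rw [lintegral_condLaw, hq, div_one]
    simp_rw [one_powENat, mul_one]
    rw [← lintegral_comp_offspring s fun m => (m : ℝ≥0∞)]
    refine lintegral_congr_ae ?_
    filter_upwards [hae] with ω hω
    simp [hω]

/-- Integrating the tangent inequality at `q` gives `q + (1 - q) m ≤ 1`, so `m ≤ 1`. If `m = 1`, the
inequality is an equality almost surely, and strict convexity leaves `X ≤ 1`. Then `X q ^ (X - 1) +
0 ^ X = 1`, so `f(0) = 0`, and `0` bounds the extinction probability, contrary to `q > 0`. -/
theorem lintegral_mul_powENat_extProb_lt_one {s : S} (hq0 : 0 < extProb D P s)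
    (hq : extProb D P s < 1) :
    ∫⁻ l, (D.offspring l : ℝ≥0∞) * powENat (extProb D P s) (D.offspring l - 1) ∂P s < 1 := by
  set q := extProb D P s with hqdef
  set u := 1 - q
  have hqu : q + u = 1 := add_tsub_cancel_of_le hq.le
  have hu0 : u ≠ 0 := (tsub_pos_of_lt hq).ne'
  have hut : u ≠ ∞ := ne_top_of_le_ne_top ENNReal.one_ne_top tsub_le_self
  set m := ∫⁻ l, (D.offspring l : ℝ≥0∞) * powENat q (D.offspring l - 1) ∂P s with hm
  have hX : Measurable fun l => (D.offspring l : ℝ≥0∞) * powENat q (D.offspring l - 1) :=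
    measurable_comp_offspring fun m => m * powENat q (m - 1)
  have hint : ∫⁻ l, powENat q (D.offspring l)
      + u * ((D.offspring l : ℝ≥0∞) * powENat q (D.offspring l - 1)) ∂P s = q + u * m := by
    rw [lintegral_add_left (measurable_comp_offspring _), lintegral_const_mul _ hX,
      lintegral_powENat_extProb hq]
  have hle : m ≤ 1 := by
    have h1 : q + u * m ≤ q + u * 1 := by
      rw [mul_one, hqu, ← hint]
      refine (lintegral_mono fun l => powENat_add_mul_le_one hqu hq _).trans (by simp)
    exact (ENNReal.mul_le_mul_iff_right hu0 hut).1 ((ENNReal.add_le_add_iff_left hq.ne_top).1 h1)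
  refine hle.lt_of_ne fun hm1 => ?_
  have hae : ∀ᵐ l ∂P s, powENat q (D.offspring l)
      + u * ((D.offspring l : ℝ≥0∞) * powENat q (D.offspring l - 1)) = 1 := by
    refine ae_eq_of_ae_le_of_lintegral_le (g := fun _ => 1)
      (ae_of_all _ fun l => powENat_add_mul_le_one hqu hq _) ?_ aemeasurable_const ?_
    · rw [hint, hm1, mul_one, hqu]; exact ENNReal.one_ne_top
    · rw [hint, hm1, mul_one, hqu]; simp
  have hae2 : ∀ᵐ l ∂P s, (D.offspring l : ℝ≥0∞) * powENat q (D.offspring l - 1)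
      + powENat 0 (D.offspring l) = 1 := by
    filter_upwards [hae] with l hl
    have h2 : D.offspring l < 2 := not_le.1 fun h =>
      (powENat_add_mul_lt_one hqu hq h).ne hl
    have h3 : D.offspring l = 0 ∨ D.offspring l = 1 := by
      obtain ⟨k, hk⟩ := ENat.ne_top_iff_exists.1 h2.ne_top
      rw [← hk] at h2 ⊢
      have : k < 2 := by exact_mod_cast h2
      interval_cases k <;> simp
    rcases h3 with h3 | h3
    · simp [h3, powENat_zero]
    · simp [h3, powENat_zero, powENat_zero_left]
  have h0 : ∫⁻ l, powENat 0 (D.offspring l) ∂P s ≤ 0 := by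
    have h1 : m + ∫⁻ l, powENat 0 (D.offspring l) ∂P s = 1 + 0 := by
      rw [hm, ← lintegral_add_left hX, lintegral_congr_ae hae2]; simp
    rw [hm1] at h1
    exact ((ENNReal.add_right_inj ENNReal.one_ne_top).1 h1).le
  exact absurd (extProb_le_of_lintegral_powENat_le zero_le_one h0) (not_le.2 hq0)

end SingleType

end Branching
end

open Branching in
theorem mainTheorem2 {S L : Type*} [MeasurableSpace S] [MeasurableSpace L]
    (D : LifeSpace S L) (P : Kernel S L) [IsMarkovKernel P] :
    (∀ q : ℝ≥0∞, q = ⨆ r, extProb D P r → q < 1 →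
      ∀ s : S, 0 < extProb D P s →
        (∀ n : ℕ,
          ∫⁻ ω, (D.genSize n ω : ℝ≥0∞) ∂(condLaw D P s)
              = (∫⁻ ω, (D.genSize n ω : ℝ≥0∞) * extWeight D P n ω ∂(popLaw D P s))
                  / extProb D P s ∧
          ∫⁻ ω, (D.genSize n ω : ℝ≥0∞) ∂(condLaw D P s)
              ≤ (∫⁻ ω, (D.genSize n ω : ℝ≥0∞) * powENat q (D.genSize n ω) ∂(popLaw D P s))
                  / extProb D P s) ∧
        IsSubcritical D (condLaw D P s) ∧
        ((∀ᵐ ω ∂(popLaw D P s),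
            Tendsto (fun n => (D.genSize n ω : ℝ≥0∞)) atTop (𝓝 0) ∨
            Tendsto (fun n => (D.genSize n ω : ℝ≥0∞)) atTop (𝓝 ∞)) →
          Tendsto (fun n =>
              (∫⁻ ω, (D.genSize n ω : ℝ≥0∞) * powENat q (D.genSize n ω) ∂(popLaw D P s))
                / extProb D P s) atTop (𝓝 0)) ∧
        (0 < ⨅ r, extProb D P r →
          ∀ᵐ ω ∂(popLaw D P s),
            Tendsto (fun n => (D.genSize n ω : ℝ≥0∞)) atTop (𝓝 0) ∨
            Tendsto (fun n => (D.genSize n ω : ℝ≥0∞)) atTop (𝓝 ∞))) ∧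
    (Subsingleton S → ∀ s : S, ∀ q : ℝ≥0∞, q = extProb D P s → 0 < q →
      ∫⁻ ω, (D.offspring (ω.2 []) : ℝ≥0∞) ∂(condLaw D P s)
          = ∫⁻ ω, (D.offspring (ω.2 []) : ℝ≥0∞) * powENat q (D.offspring (ω.2 []) - 1)
              ∂(popLaw D P s) ∧
      (1 < ∫⁻ ω, (D.offspring (ω.2 []) : ℝ≥0∞) ∂(popLaw D P s) → q < 1) ∧
      (q < 1 →
        HasDerivAt (offspringGF D P s)
          (∫⁻ ω, (D.offspring (ω.2 []) : ℝ≥0∞) ∂(condLaw D P s)).toReal q.toReal ∧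
        ∫⁻ ω, (D.offspring (ω.2 []) : ℝ≥0∞) ∂(condLaw D P s) < 1 ∧
        IsSubcritical D (condLaw D P s))) := by
  refine ⟨?_, ?_⟩
  · rintro q rfl hq s hs
    refine ⟨fun n => ⟨lintegral_genSize_condLaw hq s n, ?_⟩, isSubcritical_condLaw hq hs,
      fun h => ?_, fun hp => ae_tendsto_zero_or_top hq hp s⟩
    · rw [lintegral_genSize_condLaw hq s n]
      exact ENNReal.div_le_div_right
        (lintegral_mono fun ω => mul_le_mul_right (extWeight_le n ω) _) _
    · have := ENNReal.Tendsto.div_const (tendsto_lintegral_genSize_mul_powENat hq s h)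
        (b := extProb D P s) (Or.inr hs.ne')
      rwa [ENNReal.zero_div] at this
  · rintro hS s q rfl hq0
    refine ⟨?_, fun h => ?_, fun hq => ?_⟩
    · rw [lintegral_offspring_condLaw hq0]
      exact (lintegral_comp_offspring s fun m =>
        (m : ENNReal) * powENat (extProb D P s) (m - 1)).symm
    · rw [lintegral_comp_offspring s fun m => (m : ENNReal)] at h
      exact extProb_lt_one_of_supercritical h
    · rw [lintegral_offspring_condLaw hq0]
      refine ⟨hasDerivAt_offspringGF hq, lintegral_mul_powENat_extProb_lt_one hq0 hq, ?_⟩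
      exact isSubcritical_condLaw (by rwa [iSup_extProb_of_subsingleton s]) hq0
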